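/- Let $\mathcal A$ be a unital $C^*$-algebra, $\mathcal Y$ a complex Hilbert space and $\mathcal V$ a complex vector space; identify $\mathcal L(\mathcal Y^M)$ with $\mathcal L(\mathcal Y)^{M\times M}$, and let complex matrices act on matrices over $\mathcal A$, $\mathcal L(\mathcal Y)$ and $\mathcal V$ by matrix multiplication. For a unital subalgebra $\mathcal S\subset\mathbb C^{M\times M}$, let $C^*(\mathcal S)$ be the $C^*$-algebra it generates. $\mathcal S$ has the *complete spectral-factorization property* if for every $n$ and every strictly positive definite $\alpha\in C^*(\mathcal S)^{n\times n}$ there is $\beta\in\mathcal S^{n\times n}$ with $\alpha=\beta\beta^*$. A linear map $\phi:\mathcal A^{M\times M}\to\mathcal L(\mathcal Y^M)$ is an *$(\mathcal S,\mathcal S^*)$-bimodule map* if $\phi(\alpha P\beta^*)=\alpha\,\phi(P)\,\beta^*$ for all $\alpha,\beta\in\mathcal S$ and all $P$, and *Hermitian* if $\phi(P^*)=\phi(P)^*$. **(1)** Let $\mathcal S\subset\mathbb C^{M\times M}$ be a unital subalgebra with the complete spectral-factorization property, and let $\phi:\mathcal A^{M\times M}\to\mathcal L(\mathcal Y^M)$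 be a completely bounded Hermitian $(\mathcal S,\mathcal S^*)$-bimodule map. Then there are completely positive (cp) $(\mathcal S,\mathcal S^*)$-bimodule maps $\Phi_{11},\Phi_{22}:\mathcal A^{M\times M}\to\mathcal L(\mathcal Y^M)$ such that $$P\mapsto\begin{bmatrix}\Phi_{11}(P)&\phi(P)\\ \phi(P)&\Phi_{22}(P)\end{bmatrix}$$ is cp, and there are cp $(\mathcal S,\mathcal S^*)$-bimodule maps $\phi_1,\phi_2$ with $\phi=\phi_1-\phi_2$. **(2)** Every unital subalgebra $\mathcal S\subset\mathbb C^{M\times M}$ that is a $C^*$-algebra (i.e. closed under adjoints) has the complete spectral-factorization property. Let $\Omega=\{Z_1,\dots,Z_N\}$ be a finite set of square matrices over $\mathcal V$, $Z_i$ of size $n_i\times n_i$ with $n_i\ge1$, and put $N_0=\sum_i n_i$, $Z^{(0)}=\bigoplus_i Z_i$. The *intertwining algebra* of $\Omega$ is $\{\alpha\in\mathbb C^{N_0\times N_0}:\alpha Z^{(0)}=Z^{(0)}\alpha\}$, and $\Omega$ is *admissible* if this algebra is a $C^*$-algebra. An *nc kernel* $K$ on $\Omega$ assigns to $Z,W\in\Omega$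 of sizes $n,m$ a linear map $K(Z,W):\mathcal A^{n\times m}\to\mathcal L(\mathcal Y)^{n\times m}$ such that $\alpha K(Z,W)(P)\beta^*=K(\widetilde Z,\widetilde W)(\alpha P\beta^*)$ for all $P\in\mathcal A^{n\times m}$ whenever $Z,\widetilde Z,W,\widetilde W\in\Omega$ and complex matrices $\alpha,\beta$ satisfy $\alpha Z=\widetilde Z\alpha$ and $\beta W=\widetilde W\beta$. It is *completely bounded* if each $K(Z,W)$ is completely bounded, *Hermitian* if $K(W,Z)(P^*)=K(Z,W)(P)^*$, and *cp* if for all $W_1,\dots,W_k\in\Omega$ (repetitions allowed) the map $[P_{ij}]\mapsto[K(W_i,W_j)(P_{ij})]$ is completely positive. **(3)** If the intertwining algebra of $\Omega$ has the complete spectral-factorization property, then every completely bounded Hermitian nc kernel $K$ on $\Omega$ is a difference $K=K_1-K_2$ of two cp nc kernels on $\Omega$. **(4)** If $\Omega$ is admissible, then every completely bounded nc kernel $K$ on $\Omega$ has the form $K=K_1-K_2+i(K_3-K_4)$ with cp nc kernels $K_1,K_2,K_3,K_4$ on $\Omega$. -/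

import Mathlib

open scoped CStarAlgebra

/-! ### Scalar matrices acting on matrices over a complex vector space -/

/-- The product `α · X` of a complex matrix `α` and a matrix `X` over a complex vector space. -/
def lmul {l m n E : Type*} [Fintype m] [AddCommMonoid E] [Module ℂ E]
    (α : Matrix l m ℂ) (X : Matrix m n E) : Matrix l n E :=
  Matrix.of fun i j => ∑ k, α i k • X k j

/-- The product `X · β` of a matrix `X` over a complex vector space and a complex matrix `β`. -/
def rmul {m n l E : Type*} [Fintype n] [AddCommMonoid E] [Module ℂ E]
    (X : Matrix m n E) (β : Matrix n l ℂ) : Matrix m l E :=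
  Matrix.of fun i j => ∑ k, β k j • X i k

/-- The complex matrices that commute with a fixed square matrix over a complex vector space. -/
def commutant {m V : Type*} [Fintype m] [DecidableEq m] [AddCommGroup V] [Module ℂ V]
    (Z : Matrix m m V) : Subalgebra ℂ (Matrix m m ℂ) where
  carrier := {α | lmul α Z = rmul Z α}
  mul_mem' := by
    intro a b ha hb
    simp only [Set.mem_ofPred_eq] at ha hb ⊢
    have ha' : ∀ i j, ∑ k, a i k • Z k j = ∑ k, a k j • Z i k :=
      fun i j => congrFun (congrFun ha i) j
    have hb' : ∀ i j, ∑ k, b i k • Z k j = ∑ k, b k j • Z i k :=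
      fun i j => congrFun (congrFun hb i) j
    ext i j
    simp only [lmul, rmul, Matrix.of_apply, Matrix.mul_apply, Finset.sum_smul, mul_smul]
    calc ∑ k, ∑ x, a i x • b x k • Z k j
        = ∑ x, a i x • ∑ k, b x k • Z k j := by
          rw [Finset.sum_comm]; simp only [Finset.smul_sum]
      _ = ∑ x, a i x • ∑ k, b k j • Z x k := by simp only [hb']
      _ = ∑ k, b k j • ∑ x, a i x • Z x k := by
          simp only [Finset.smul_sum]
          rw [Finset.sum_comm]
          simp only [smul_comm (a _ _) (b _ _)]
      _ = ∑ k, b k j • ∑ x, a x k • Z i x := by simp only [ha']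
      _ = ∑ x, ∑ k, a x k • b k j • Z i x := by
          simp only [Finset.smul_sum]
          rw [Finset.sum_comm]
          simp only [smul_comm (b _ _) (a _ _)]
  add_mem' := by
    intro a b ha hb
    simp only [Set.mem_ofPred_eq] at ha hb ⊢
    have ha' : ∀ i j, ∑ k, a i k • Z k j = ∑ k, a k j • Z i k :=
      fun i j => congrFun (congrFun ha i) j
    have hb' : ∀ i j, ∑ k, b i k • Z k j = ∑ k, b k j • Z i k :=
      fun i j => congrFun (congrFun hb i) j
    ext i j
    simp only [lmul, rmul, Matrix.of_apply, Matrix.add_apply, add_smul, Finset.sum_add_distrib,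
      ha', hb']
  algebraMap_mem' := by
    intro r
    simp only [Set.mem_ofPred_eq]
    ext i j
    simp [lmul, rmul, Matrix.algebraMap_matrix_apply, ite_smul]

/-! ### Maps between matrix algebras over C*-algebras

`Matrix m n A` over a C*-algebra `A` carries its C*-norm and, for `m = n`, its C*-order through
the type copy `CStarMatrix m n A`. -/

section Maps

variable {m n m' n' A B : Type*} [Fintype m] [Fintype n] [Fintype m'] [Fintype n']
  [CStarAlgebra A] [PartialOrder A] [StarOrderedRing A]
  [CStarAlgebra B] [PartialOrder B] [StarOrderedRing B]

/-- `φ` is completely positive as a map between the C*-algebras of matrices over `A` and `B`. -/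
def IsCompletelyPositive (φ : Matrix m m A →ₗ[ℂ] Matrix m' m' B) : Prop :=
  ∃ f : CStarMatrix m m A →CP CStarMatrix m' m' B,
    ∀ P : Matrix m m A, f (CStarMatrix.ofMatrix P) = CStarMatrix.ofMatrix (φ P)

/-- `φ` is completely bounded: its amplifications, which apply `φ` to the entries of a `k × k`
matrix, are bounded uniformly in `k`. A `k × k` matrix with entries in `Matrix m n A` is normed as
an element of `Matrix (Fin k × m) (Fin k × n) A`. -/
def IsCompletelyBounded (φ : Matrix m n A →ₗ[ℂ] Matrix m' n' B) : Prop :=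
  ∃ C : ℝ, ∀ (k : ℕ) (X : Matrix (Fin k) (Fin k) (Matrix m n A)),
    ‖CStarMatrix.ofMatrix (Matrix.comp (Fin k) (Fin k) m' n' B (X.map φ))‖ ≤
      C * ‖CStarMatrix.ofMatrix (Matrix.comp (Fin k) (Fin k) m n A X)‖

/-- `φ` is Hermitian: `φ(P*) = φ(P)*`. -/
def IsHermitianMap (φ : Matrix m m A →ₗ[ℂ] Matrix m' m' B) : Prop :=
  ∀ P : Matrix m m A, φ P.conjTranspose = (φ P).conjTranspose

/-- `φ` is an `(S, S*)`-bimodule map: `φ(α P β*) = α φ(P) β*` for `α, β ∈ S`. -/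
def IsBimoduleMap [DecidableEq m] (S : Subalgebra ℂ (Matrix m m ℂ))
    (φ : Matrix m m A →ₗ[ℂ] Matrix m m B) : Prop :=
  ∀ α ∈ S, ∀ β ∈ S, ∀ P : Matrix m m A,
    φ (rmul (lmul α P) β.conjTranspose) = rmul (lmul α (φ P)) β.conjTranspose

/-- The map `P ↦ [Φ₁₁(P), φ(P); φ(P), Φ₂₂(P)]`. -/
noncomputable def offDiagonalMap (Φ₁₁ φ Φ₂₂ : Matrix m m A →ₗ[ℂ] Matrix m m B) :
    Matrix m m A →ₗ[ℂ] Matrix (m ⊕ m) (m ⊕ m) B where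
  toFun P := Matrix.fromBlocks (Φ₁₁ P) (φ P) (φ P) (Φ₂₂ P)
  map_add' P Q := by simp [Matrix.fromBlocks_add]
  map_smul' c P := by simp [Matrix.fromBlocks_smul]

end Maps

open scoped ComplexOrder in
/-- The complete spectral-factorization property of a unital subalgebra `S` of the complex
matrices: every strictly positive definite matrix over the C*-algebra generated by `S` factors as
`β β*` with a matrix `β` over `S`. -/
def HasCompleteSpectralFactorization {m : Type*} [Fintype m] [DecidableEq m]
    (S : Subalgebra ℂ (Matrix m m ℂ)) : Prop :=
  ∀ (n : ℕ) (α : Matrix (Fin n) (Fin n) (Matrix m m ℂ)),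
    (∀ i j, α i j ∈ StarAlgebra.adjoin ℂ (S : Set (Matrix m m ℂ))) →
    (Matrix.comp (Fin n) (Fin n) m m ℂ α).PosDef →
    ∃ β : Matrix (Fin n) (Fin n) (Matrix m m ℂ),
      (∀ i j, β i j ∈ S) ∧ α = β * β.conjTranspose

/-- `S` is a C*-algebra, i.e. closed under the adjoint (closedness in norm is automatic in
finite dimension). -/
def IsAdjointClosed {m : Type*} [Fintype m] [DecidableEq m]
    (S : Subalgebra ℂ (Matrix m m ℂ)) : Prop :=
  ∀ α ∈ S, α.conjTranspose ∈ S

/-! ### Noncommutative points and kernels -/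

/-- The nc space over `V`: square matrices over `V` of all sizes `n ≥ 1`. -/
abbrev NCSpace (V : Type*) : Type _ := Σ n : ℕ+, Matrix (Fin n) (Fin n) V

/-- A graded kernel on `Ω`: for points `Z`, `W` of sizes `n`, `m`, a linear map from `n × m`
matrices over `A` to `n × m` matrices over `B`. -/
abbrev GradedKernel {V : Type*} (Ω : Set (NCSpace V)) (A B : Type*)
    [AddCommMonoid A] [Module ℂ A] [AddCommMonoid B] [Module ℂ B] : Type _ :=
  ∀ Z W : Ω, Matrix (Fin Z.1.1) (Fin W.1.1) A →ₗ[ℂ] Matrix (Fin Z.1.1) (Fin W.1.1) B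

section Kernels

variable {V A B : Type*} [AddCommGroup V] [Module ℂ V] {Ω : Set (NCSpace V)}

/-- The direct sum of all points of a finite set `Ω`. -/
def directSum (Ω : Set (NCSpace V)) [DecidableEq Ω] :
    Matrix (Σ Z : Ω, Fin Z.1.1) (Σ Z : Ω, Fin Z.1.1) V :=
  Matrix.blockDiagonal' fun Z : Ω => Z.1.2

/-- The intertwining algebra of a finite set `Ω`. -/
def intertwiningAlgebra (Ω : Set (NCSpace V)) [Fintype Ω] [DecidableEq Ω] :
    Subalgebra ℂ (Matrix (Σ Z : Ω, Fin Z.1.1) (Σ Z : Ω, Fin Z.1.1) ℂ) :=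
  commutant (directSum Ω)

/-- A finite set of points is admissible if its intertwining algebra is a C*-algebra. -/
def IsAdmissible (Ω : Set (NCSpace V)) [Fintype Ω] [DecidableEq Ω] : Prop :=
  IsAdjointClosed (intertwiningAlgebra Ω)

/-- The graded kernel `K` respects intertwinings. -/
def IsNCKernel [AddCommGroup A] [Module ℂ A] [AddCommGroup B] [Module ℂ B]
    (K : GradedKernel Ω A B) : Prop :=
  ∀ (Z Z' W W' : Ω) (α : Matrix (Fin Z'.1.1) (Fin Z.1.1) ℂ)
    (β : Matrix (Fin W'.1.1) (Fin W.1.1) ℂ),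
    lmul α Z.1.2 = rmul Z'.1.2 α → lmul β W.1.2 = rmul W'.1.2 β →
    ∀ P : Matrix (Fin Z.1.1) (Fin W.1.1) A,
      rmul (lmul α (K Z W P)) β.conjTranspose = K Z' W' (rmul (lmul α P) β.conjTranspose)

/-- For points `Z₁, …, Z_k`, the map `[P_{ij}] ↦ [K(Z_i, Z_j)(P_{ij})]`. -/
def blockMap [AddCommMonoid A] [Module ℂ A] [AddCommMonoid B] [Module ℂ B]
    (K : GradedKernel Ω A B) {k : ℕ} (Z : Fin k → Ω) :
    Matrix (Σ i, Fin (Z i).1.1) (Σ i, Fin (Z i).1.1) A →ₗ[ℂ]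
      Matrix (Σ i, Fin (Z i).1.1) (Σ i, Fin (Z i).1.1) B where
  toFun P := Matrix.of fun p q =>
    K (Z p.1) (Z q.1) (Matrix.of fun a b => P ⟨p.1, a⟩ ⟨q.1, b⟩) p.2 q.2
  map_add' P Q := by
    ext p q
    exact congrFun (congrFun (map_add (K (Z p.1) (Z q.1))
      (Matrix.of fun a b => P ⟨p.1, a⟩ ⟨q.1, b⟩) (Matrix.of fun a b => Q ⟨p.1, a⟩ ⟨q.1, b⟩))
      p.2) q.2
  map_smul' c P := by
    ext p q
    exact congrFun (congrFun (map_smul (K (Z p.1) (Z q.1)) c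
      (Matrix.of fun a b => P ⟨p.1, a⟩ ⟨q.1, b⟩)) p.2) q.2

variable [CStarAlgebra A] [PartialOrder A] [StarOrderedRing A]
  [CStarAlgebra B] [PartialOrder B] [StarOrderedRing B]

/-- `K` is a cp nc kernel: an nc kernel such that `[P_{ij}] ↦ [K(Z_i, Z_j)(P_{ij})]` is completely
positive for all points `Z₁, …, Z_k` of `Ω` (repetitions allowed). -/
def IsCPNCKernel (K : GradedKernel Ω A B) : Prop :=
  IsNCKernel K ∧ ∀ (k : ℕ) (Z : Fin k → Ω), IsCompletelyPositive (blockMap K Z)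

/-- `K` is Hermitian: `K(W, Z)(P*) = K(Z, W)(P)*`. -/
def IsHermitianKernel (K : GradedKernel Ω A B) : Prop :=
  ∀ (Z W : Ω) (P : Matrix (Fin Z.1.1) (Fin W.1.1) A),
    K W Z P.conjTranspose = (K Z W P).conjTranspose

/-- `K` is completely bounded: each of the maps `K(Z, W)` is. -/
def IsCBKernel (K : GradedKernel Ω A B) : Prop :=
  ∀ Z W : Ω, IsCompletelyBounded (K Z W)

end Kernels

/-! The bimodule or kernel condition is stripped off by finite-dimensional linear algebra; what
remains is the classical Wittstock decomposition.

Let T be the space of families (X_Z) of square matrices with α X_Z = X_{Z'} α for all intertwiners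
α. A bimodule map is the case of one point, with T the commutant of S. Fix W, d, c and p ∈ A, and
let E_{bd} be the matrix units: the matrices with (a, b) entry K(Z,W)(p E_{bd})_{ac} form a family
over Z that intertwines as well, only with operator entries. A linear projection onto T, applied to
matrix units, gives X_i ∈ T with Q = ∑ Q_i X_i for every Q ∈ T, where Q_i is the entry of Q at
position i (`Submodule.exists_eq_sum_entry_smul`). Using this on the left and, by Hermitian
symmetry, on the right yields K(Z,W)(P) = ∑ X_i(Z) θ_ij(P) X_j(W)*, with θ_ij : A → L(Y) applied
entrywise. Now θ is a finite Hermitian matrix of completely bounded maps under no module condition.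
If θ = ψ₁ - ψ₂ with ψ₁, ψ₂ completely positive, replacing θ by ψ₁ and ψ₂ keeps complete positivity,
and the X_i alone guarantee the intertwining (`exists_conjSum_sub_conjSum`).

For the Wittstock decomposition (`exists_isFormPositive_sub`), a map φ : A → L(H) is encoded as the
functional x ↦ ∑ ⟪h, φ(x(h,k)) k⟫ on finitely supported matrices over A indexed by the vectors of H.
The M. Riesz extension theorem produces a functional that is nonnegative on squares v*v, dominates
that of φ there, and is at most C‖∑ w_h h‖² on scalar squares w*w (`exists_dominating_functional`).
By Cauchy–Schwarz the last bound makes it a family of bounded sesquilinear forms, that is, a map ψ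
with ψ and ψ - φ completely positive (`exists_linearMap_of_functional`).

Spectral factorization in a C*-algebra holds because the square root of a positive matrix is a
polynomial in it. A general kernel is split into its real and imaginary parts. -/

open scoped ComplexOrder

/-! ### Kernels with finite support -/

section FreeKernel

variable {ι R A : Type*}

/-- The matrix `(p, q) ↦ v(p)* w(q)`. -/
noncomputable def outerProduct [Semiring R] [StarRing R] (v w : ι →₀ R) : ι × ι →₀ R :=
  Finsupp.onFinset (v.support ×ˢ w.support) (fun x => star (v x.1) * w x.2) fun x hx => by
    rw [Finset.mem_product, Finsupp.mem_support_iff, Finsupp.mem_support_iff]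
    constructor <;> rintro h <;> simp [h] at hx

@[simp]
lemma outerProduct_apply [Semiring R] [StarRing R] (v w : ι →₀ R) (x : ι × ι) :
    outerProduct v w x = star (v x.1) * w x.2 := rfl

lemma outerProduct_add_left [Semiring R] [StarRing R] (v v' w : ι →₀ R) :
    outerProduct (v + v') w = outerProduct v w + outerProduct v' w := by
  ext x; simp [add_mul]

lemma outerProduct_add_right [Semiring R] [StarRing R] (v w w' : ι →₀ R) :
    outerProduct v (w + w') = outerProduct v w + outerProduct v w' := by
  ext x; simp [mul_add]

lemma outerProduct_sum_sum [Semiring R] [StarRing R] {κ : Type*} (s : Finset κ)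
    (v w : κ → ι →₀ R) :
    outerProduct (∑ i ∈ s, v i) (∑ i ∈ s, w i) = ∑ i ∈ s, ∑ j ∈ s, outerProduct (v i) (w j) := by
  ext x
  simp [Finsupp.finsetSum_apply, Finset.sum_mul_sum]

@[simp]
lemma outerProduct_single [Semiring R] [StarRing R] (p q : ι) (a b : R) :
    outerProduct (Finsupp.single p a) (Finsupp.single q b) =
      Finsupp.single (p, q) (star a * b) := by
  classical
  ext ⟨i, j⟩
  simp only [outerProduct_apply, Finsupp.single_apply, Prod.mk.injEq]
  split_ifs <;> simp_all

/-- The matrix `(p, q) ↦ x(q, p)*`. -/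
noncomputable def kernelAdjoint [AddMonoid R] [StarAddMonoid R] (x : ι × ι →₀ R) : ι × ι →₀ R :=
  Finsupp.equivMapDomain (Equiv.prodComm ι ι) (x.mapRange star (star_zero R))

@[simp]
lemma kernelAdjoint_apply [AddMonoid R] [StarAddMonoid R] (x : ι × ι →₀ R) (p q : ι) :
    kernelAdjoint x (p, q) = star (x (q, p)) := by
  simp [kernelAdjoint]

@[simp]
lemma kernelAdjoint_outerProduct [Semiring R] [StarRing R] (v w : ι →₀ R) :
    kernelAdjoint (outerProduct v w) = outerProduct w v := by
  ext ⟨p, q⟩; simp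

@[simp]
lemma kernelAdjoint_single [AddMonoid R] [StarAddMonoid R] (p q : ι) (a : R) :
    kernelAdjoint (Finsupp.single (p, q) a) = Finsupp.single (q, p) (star a) := by
  classical
  ext ⟨i, j⟩
  simp only [kernelAdjoint_apply, Finsupp.single_apply, Prod.mk.injEq]
  split_ifs <;> simp_all

@[simp]
lemma kernelAdjoint_zero [AddMonoid R] [StarAddMonoid R] :
    kernelAdjoint (0 : ι × ι →₀ R) = 0 := by
  ext ⟨p, q⟩; simp

lemma kernelAdjoint_add [AddCommMonoid R] [StarAddMonoid R] (x y : ι × ι →₀ R) :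
    kernelAdjoint (x + y) = kernelAdjoint x + kernelAdjoint y := by
  ext ⟨p, q⟩; simp

lemma kernelAdjoint_neg [AddCommGroup R] [StarAddMonoid R] (x : ι × ι →₀ R) :
    kernelAdjoint (-x) = -kernelAdjoint x := by
  ext ⟨p, q⟩; simp

lemma kernelAdjoint_smul [CStarAlgebra A] (c : ℂ) (x : ι × ι →₀ A) :
    kernelAdjoint (c • x) = star c • kernelAdjoint x := by
  ext ⟨p, q⟩; simp

lemma kernelAdjoint_real_smul [CStarAlgebra A] (c : ℝ) (x : ι × ι →₀ A) :
    kernelAdjoint (c • x) = c • kernelAdjoint x := by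
  ext ⟨p, q⟩; simp

/-- The sums of matrices of the form `v* v`. -/
noncomputable def squareCone (ι R : Type*) [Semiring R] [StarRing R] : AddSubmonoid (ι × ι →₀ R) :=
  AddSubmonoid.closure (Set.range fun v => outerProduct v v)

lemma outerProduct_mem_squareCone [Semiring R] [StarRing R] (v : ι →₀ R) :
    outerProduct v v ∈ squareCone ι R :=
  AddSubmonoid.subset_closure ⟨v, rfl⟩

lemma smul_mem_squareCone [CStarAlgebra A] {r : ℝ} (hr : 0 ≤ r) {x : ι × ι →₀ A}
    (hx : x ∈ squareCone ι A) : r • x ∈ squareCone ι A := by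
  induction hx using AddSubmonoid.closure_induction with
  | mem x hx =>
    obtain ⟨v, rfl⟩ := hx
    have : r • outerProduct v v = outerProduct (√r • v) (√r • v) := by
      ext x
      simp [smul_smul, Real.mul_self_sqrt hr]
    exact this ▸ outerProduct_mem_squareCone _
  | zero => simp
  | add x y _ _ hx hy => exact smul_add r x y ▸ add_mem hx hy

/-- The matrices whose Hermitian part is a sum of matrices of the form `v* v`. -/
noncomputable def accretiveCone (ι A : Type*) [CStarAlgebra A] : PointedCone ℝ (ι × ι →₀ A) where
  carrier := {x | x + kernelAdjoint x ∈ squareCone ι A}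
  add_mem' := by
    intro x y hx hy
    simp only [Set.mem_ofPred_eq] at hx hy ⊢
    rw [kernelAdjoint_add, add_add_add_comm]
    exact add_mem hx hy
  zero_mem' := by simp
  smul_mem' := by
    intro r x hx
    simp only [Set.mem_ofPred_eq] at hx ⊢
    have := smul_mem_squareCone r.2 hx
    rwa [smul_add, ← kernelAdjoint_real_smul] at this

lemma mem_accretiveCone [CStarAlgebra A] {x : ι × ι →₀ A} :
    x ∈ accretiveCone ι A ↔ x + kernelAdjoint x ∈ squareCone ι A := Iff.rfl

lemma kernelAdjoint_of_mem_squareCone [CStarAlgebra A] {x : ι × ι →₀ A}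
    (hx : x ∈ squareCone ι A) : kernelAdjoint x = x := by
  induction hx using AddSubmonoid.closure_induction with
  | mem x hx => obtain ⟨v, rfl⟩ := hx; simp
  | zero => simp
  | add x y _ _ hx hy => rw [kernelAdjoint_add, hx, hy]

lemma squareCone_le_accretiveCone [CStarAlgebra A] {x : ι × ι →₀ A}
    (hx : x ∈ squareCone ι A) : x ∈ accretiveCone ι A := by
  rw [mem_accretiveCone, kernelAdjoint_of_mem_squareCone hx]
  exact add_mem hx hx

/-- Scalar matrices as matrices over a unital algebra. -/
noncomputable def scalarKernel (ι A : Type*) [CStarAlgebra A] : (ι × ι →₀ ℂ) →ₗ[ℂ] (ι × ι →₀ A) :=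
  Finsupp.mapRange.linearMap (Algebra.linearMap ℂ A)

@[simp]
lemma scalarKernel_apply [CStarAlgebra A] (z : ι × ι →₀ ℂ) (x : ι × ι) :
    scalarKernel ι A z x = algebraMap ℂ A (z x) := by
  simp [scalarKernel]

lemma scalarKernel_outerProduct [CStarAlgebra A] (v w : ι →₀ ℂ) :
    scalarKernel ι A (outerProduct v w) = outerProduct
      (v.mapRange (algebraMap ℂ A) (map_zero _)) (w.mapRange (algebraMap ℂ A) (map_zero _)) := by
  ext x
  simp [← algebraMap_star_comm]

lemma scalarKernel_kernelAdjoint [CStarAlgebra A] (z : ι × ι →₀ ℂ) :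
    scalarKernel ι A (kernelAdjoint z) = kernelAdjoint (scalarKernel ι A z) := by
  ext ⟨p, q⟩
  simp [← algebraMap_star_comm]

lemma scalarKernel_mem_squareCone [CStarAlgebra A] {z : ι × ι →₀ ℂ} (hz : z ∈ squareCone ι ℂ) :
    scalarKernel ι A z ∈ squareCone ι A := by
  induction hz using AddSubmonoid.closure_induction with
  | mem x hx =>
    obtain ⟨v, rfl⟩ := hx
    simp only [scalarKernel_outerProduct]
    exact outerProduct_mem_squareCone _
  | zero => simp
  | add x y _ _ hx hy => exact (map_add (scalarKernel ι A) x y).symm ▸ add_mem hx hy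

lemma scalarKernel_mem_accretiveCone [CStarAlgebra A] {z : ι × ι →₀ ℂ}
    (hz : z ∈ accretiveCone ι ℂ) : scalarKernel ι A z ∈ accretiveCone ι A := by
  rw [mem_accretiveCone, ← scalarKernel_kernelAdjoint, ← map_add]
  exact scalarKernel_mem_squareCone hz

/-- Scalar matrices absorb every matrix into the cone. -/
lemma exists_scalarKernel_add_mem_accretiveCone [CStarAlgebra A] [PartialOrder A]
    [StarOrderedRing A] (x : ι × ι →₀ A) :
    ∃ r ∈ accretiveCone ι ℂ, scalarKernel ι A r + x ∈ accretiveCone ι A := by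
  induction x using Finsupp.induction_linear with
  | zero => exact ⟨0, zero_mem _, by simp⟩
  | add x y hx hy =>
    obtain ⟨r, hr, hrx⟩ := hx
    obtain ⟨s, hs, hsy⟩ := hy
    refine ⟨r + s, add_mem hr hs, ?_⟩
    rw [map_add, add_add_add_comm]
    exact add_mem hrx hsy
  | single pq a =>
    obtain ⟨p, q⟩ := pq
    -- The scalar matrix E_pp + ‖a‖² E_qq. Writing ‖a‖² - a*a = b*b, it completes a E_pq + a* E_qp
    -- to the two squares of e_p + a e_q and b e_q. The Hermitian part counts the scalar matrix
    -- twice: one copy is spent on these squares, the other is itself a sum of squares.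
    set r : ι × ι →₀ ℂ := outerProduct (Finsupp.single p 1) (Finsupp.single p 1) +
      (‖a‖ ^ 2) • outerProduct (Finsupp.single q 1) (Finsupp.single q 1) with hr
    have hrs : r ∈ squareCone ι ℂ :=
      add_mem (outerProduct_mem_squareCone _)
        (smul_mem_squareCone (by positivity) (outerProduct_mem_squareCone _))
    refine ⟨r, squareCone_le_accretiveCone hrs, ?_⟩
    obtain ⟨b, hb⟩ := CStarAlgebra.nonneg_iff_eq_star_mul_self.mp
      (sub_nonneg.mpr (CStarAlgebra.star_mul_le_algebraMap_norm_sq (a := a)))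
    have key : scalarKernel ι A r + Finsupp.single (p, q) a +
        kernelAdjoint (scalarKernel ι A r + Finsupp.single (p, q) a) =
        scalarKernel ι A r +
          (outerProduct (Finsupp.single p 1 + Finsupp.single q a)
            (Finsupp.single p 1 + Finsupp.single q a) +
          outerProduct (Finsupp.single q b) (Finsupp.single q b)) := by
      rw [kernelAdjoint_add, ← scalarKernel_kernelAdjoint, kernelAdjoint_of_mem_squareCone hrs,
        outerProduct_single, ← hb, kernelAdjoint_single]
      have hr' : scalarKernel ι A r = Finsupp.single (p, p) 1 +
          Finsupp.single (q, q) (algebraMap ℝ A (‖a‖ ^ 2)) := by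
        simp only [hr, scalarKernel, outerProduct_single, map_add]
        simp [Algebra.algebraMap_eq_smul_one, - Complex.ofReal_pow, Complex.coe_smul]
      simp only [outerProduct_add_left, outerProduct_add_right, outerProduct_single,
        Finsupp.single_sub, hr']
      simp only [star_one, one_mul, mul_one]
      abel
    rw [mem_accretiveCone, key]
    exact add_mem (scalarKernel_mem_squareCone hrs)
      (add_mem (outerProduct_mem_squareCone _) (outerProduct_mem_squareCone _))

end FreeKernel

/-! ### Decomposition of completely bounded maps: the functional -/

lemma Finset.sum_reverse_four {ι₁ ι₂ ι₃ ι₄ M : Type*} [AddCommMonoid M] (s : Finset ι₁)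
    (t : Finset ι₂) (u : Finset ι₃) (v : Finset ι₄) (f : ι₁ → ι₂ → ι₃ → ι₄ → M) :
    ∑ i ∈ s, ∑ j ∈ t, ∑ k ∈ u, ∑ l ∈ v, f i j k l =
      ∑ l ∈ v, ∑ k ∈ u, ∑ j ∈ t, ∑ i ∈ s, f i j k l := by
  have h : ∀ i, ∑ j ∈ t, ∑ k ∈ u, ∑ l ∈ v, f i j k l =
      ∑ l ∈ v, ∑ k ∈ u, ∑ j ∈ t, f i j k l := fun i => by
    rw [Finset.sum_comm, Finset.sum_comm (s := v)]
    exact Finset.sum_congr rfl fun k _ => Finset.sum_comm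
  simp only [h]
  rw [Finset.sum_comm]
  refine Finset.sum_congr rfl fun l _ => ?_
  rw [Finset.sum_comm]
  exact Finset.sum_congr rfl fun k _ => Finset.sum_comm

section Functional

variable {A H : Type*} [CStarAlgebra A] [NormedAddCommGroup H] [InnerProductSpace ℂ H]

lemma sum_inner_eq_sum_mul {k : ℕ} (w : Matrix (Fin k) (Fin k) ℂ) (e : Fin k → H) :
    ((∑ l, ‖∑ j, w l j • e j‖ ^ 2 : ℝ) : ℂ) =
      ∑ i, ∑ j, (w.conjTranspose * w) i j * inner ℂ (e i) (e j) := by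
  have h : ∀ x : H, ((‖x‖ ^ 2 : ℝ) : ℂ) = inner ℂ x x := fun x => by
    rw [inner_self_eq_norm_sq_to_K]; norm_cast
  simp only [Complex.ofReal_sum, h, sum_inner, inner_sum,
    inner_smul_left, inner_smul_right, Matrix.mul_apply, Matrix.conjTranspose_apply,
    Finset.sum_mul, Finset.mul_sum]
  rw [Finset.sum_comm]
  conv_rhs => rw [Finset.sum_comm]
  refine Finset.sum_congr rfl fun j _ => ?_
  rw [Finset.sum_comm]
  refine Finset.sum_congr rfl fun i _ => Finset.sum_congr rfl fun l _ => ?_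
  rw [starRingEnd_apply]
  ring

/-- Scalars pass through φ, so congruence by a scalar matrix w moves onto the vectors. -/
lemma sum_inner_apply_congruence {k : ℕ} (φ : A →ₗ[ℂ] H →L[ℂ] H)
    (w : Matrix (Fin k) (Fin k) ℂ) (d : CStarMatrix (Fin k) (Fin k) A) (e : Fin k → H) :
    ∑ i, ∑ j, inner ℂ (e i) (φ ((star (CStarMatrix.ofMatrix (w.map (algebraMap ℂ A))) * d *
        CStarMatrix.ofMatrix (w.map (algebraMap ℂ A))) i j) (e j)) =
      ∑ l, ∑ m, inner ℂ (∑ i, w l i • e i) (φ (d l m) (∑ j, w m j • e j)) := by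
  simp only [CStarMatrix.mul_apply, CStarMatrix.star_apply, CStarMatrix.ofMatrix_apply,
    Matrix.map_apply, ← algebraMap_star_comm, ← Algebra.commutes, ← Algebra.smul_def,
    Finset.smul_sum, map_sum, map_smul, sum_apply, smul_apply,
    inner_sum, sum_inner, inner_smul_left, inner_smul_right]
  simp only [Finset.mul_sum]
  rw [Finset.sum_reverse_four]
  refine Finset.sum_congr rfl fun l _ => Finset.sum_congr rfl fun m _ =>
    Finset.sum_congr rfl fun j _ => Finset.sum_congr rfl fun i _ => ?_
  rw [starRingEnd_apply]

variable [PartialOrder A] [StarOrderedRing A]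

/-- Complete boundedness in terms of the sesquilinear forms of the amplifications. -/
def IsFormBounded (φ : A →ₗ[ℂ] H →L[ℂ] H) (C : ℝ) : Prop :=
  ∀ (k : ℕ) (d : CStarMatrix (Fin k) (Fin k) A) (y : Fin k → H),
    ‖∑ i, ∑ j, inner ℂ (y i) (φ (d i j) (y j))‖ ≤ C * ‖d‖ * ∑ i, ‖y i‖ ^ 2

/-- Write u = w*w with w invertible. Then c = w* d w with 0 ≤ d ≤ 1, hence ‖d‖ ≤ 1; the form bound
is applied to d and the vectors we, whose squared norms add up to the Gram sum of u. -/
lemma re_sum_inner_le_of_le_posDef {φ : A →ₗ[ℂ] H →L[ℂ] H} {C : ℝ} (hC : 0 ≤ C)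
    (hφ : IsFormBounded φ C) {k : ℕ} {c : CStarMatrix (Fin k) (Fin k) A} (hc : 0 ≤ c)
    {u : Matrix (Fin k) (Fin k) ℂ} (hu : u.PosDef)
    (hcu : c ≤ CStarMatrix.ofMatrix (u.map (algebraMap ℂ A))) (e : Fin k → H) :
    (∑ i, ∑ j, inner ℂ (e i) (φ (c i j) (e j))).re ≤
      C * (∑ i, ∑ j, u i j * inner ℂ (e i) (e j)).re := by
  open scoped MatrixOrder in
  obtain ⟨w, rfl⟩ := CStarAlgebra.nonneg_iff_eq_star_mul_self.mp hu.posSemidef.nonneg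
  have hw : IsUnit w := by
    have := hu.isUnit
    rw [Matrix.isUnit_iff_isUnit_det, Matrix.det_mul] at this
    exact (Matrix.isUnit_iff_isUnit_det w).mpr (isUnit_of_mul_isUnit_right this)
  obtain ⟨w, rfl⟩ := hw
  set T : Matrix (Fin k) (Fin k) ℂ →+* CStarMatrix (Fin k) (Fin k) A :=
    CStarMatrix.ofMatrixRingEquiv.toRingHom.comp (algebraMap ℂ A).mapMatrix with hT
  have hTapply : ∀ v, T v = CStarMatrix.ofMatrix (v.map (algebraMap ℂ A)) := fun v => rfl
  have hTstar : ∀ v, T (star v) = star (T v) := fun v => by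
    ext i j
    simp [hTapply, CStarMatrix.star_apply, Matrix.star_apply, ← algebraMap_star_comm]
  have hTw : T ↑w⁻¹ * T w = 1 := by rw [← map_mul]; simp
  have hTw' : T w * T ↑w⁻¹ = 1 := by rw [← map_mul]; simp
  rw [← hTapply, map_mul, hTstar] at hcu
  set d := star (T ↑w⁻¹) * c * T ↑w⁻¹ with hd
  have hcd : c = star (T w) * d * T w := by
    have h1 : star (T w) * star (T ↑w⁻¹) = 1 := by rw [← star_mul, hTw, star_one]
    calc c = (star (T w) * star (T ↑w⁻¹)) * c * (T ↑w⁻¹ * T w) := by rw [h1, hTw, one_mul, mul_one]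
      _ = _ := by simp only [hd, mul_assoc]
  have hd0 : 0 ≤ d := star_left_conjugate_nonneg hc _
  have hd1 : d ≤ 1 := by
    have h := star_left_conjugate_le_conjugate hcu (T ↑w⁻¹)
    have h1 : star (T ↑w⁻¹) * star (T w) = 1 := by rw [← star_mul, hTw', star_one]
    have h2 : star (T ↑w⁻¹) * (star (T w) * T w) * T ↑w⁻¹ = 1 := by
      rw [← mul_assoc, h1, one_mul, hTw']
    rwa [h2] at h
  have hdn : ‖d‖ ≤ 1 := (CStarAlgebra.norm_le_one_iff_of_nonneg d hd0).mpr hd1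
  have h := hφ k d fun l => ∑ j, (w : Matrix (Fin k) (Fin k) ℂ) l j • e j
  rw [hcd, hTapply, sum_inner_apply_congruence, Matrix.star_eq_conjTranspose,
    ← sum_inner_eq_sum_mul, Complex.ofReal_re]
  refine (Complex.re_le_norm _).trans (h.trans ?_)
  refine mul_le_mul_of_nonneg_right ?_ (Finset.sum_nonneg fun _ _ => by positivity)
  exact mul_le_of_le_one_right hC hdn

/-- Perturbing u to u + ε makes it invertible at a cost linear in ε, and ε is arbitrary. -/
lemma re_sum_inner_le_of_le_posSemidef {φ : A →ₗ[ℂ] H →L[ℂ] H} {C : ℝ} (hC : 0 ≤ C)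
    (hφ : IsFormBounded φ C) {k : ℕ} {c : CStarMatrix (Fin k) (Fin k) A} (hc : 0 ≤ c)
    {u : Matrix (Fin k) (Fin k) ℂ} (hu : u.PosSemidef)
    (hcu : c ≤ CStarMatrix.ofMatrix (u.map (algebraMap ℂ A))) (e : Fin k → H) :
    (∑ i, ∑ j, inner ℂ (e i) (φ (c i j) (e j))).re ≤
      C * (∑ i, ∑ j, u i j * inner ℂ (e i) (e j)).re := by
  have key : ∀ ε : ℝ, 0 < ε → (∑ i, ∑ j, inner ℂ (e i) (φ (c i j) (e j))).re ≤
      C * (∑ i, ∑ j, u i j * inner ℂ (e i) (e j)).re + ε * (C * ∑ i, ‖e i‖ ^ 2) := by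
    intro ε hε
    have hpd : (u + ε • (1 : Matrix (Fin k) (Fin k) ℂ)).PosDef :=
      Matrix.PosDef.posSemidef_add hu (Matrix.PosDef.one.smul hε)
    have hle : c ≤ CStarMatrix.ofMatrix
        ((u + ε • (1 : Matrix (Fin k) (Fin k) ℂ)).map (algebraMap ℂ A)) := by
      have h1 : CStarMatrix.ofMatrix ((u + ε • (1 : Matrix (Fin k) (Fin k) ℂ)).map (algebraMap ℂ A))
          = CStarMatrix.ofMatrix (u.map (algebraMap ℂ A)) + algebraMap ℝ _ ε := by
        ext i j
        rw [Algebra.algebraMap_eq_smul_one]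
        by_cases hij : i = j
        · subst hij
          simp [Algebra.algebraMap_eq_smul_one, add_smul]
        · simp [hij]
      rw [h1]
      refine hcu.trans (le_add_of_nonneg_right ?_)
      rw [Algebra.algebraMap_eq_smul_one]
      exact smul_nonneg hε.le zero_le_one
    refine (re_sum_inner_le_of_le_posDef hC hφ hc hpd hle e).trans (le_of_eq ?_)
    have h2 : ∑ i, ∑ j, (u + ε • (1 : Matrix (Fin k) (Fin k) ℂ)) i j * inner ℂ (e i) (e j) =
        ∑ i, ∑ j, u i j * inner ℂ (e i) (e j) + ((ε * ∑ i, ‖e i‖ ^ 2 : ℝ) : ℂ) := by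
      simp [Matrix.one_apply, add_mul, Finset.sum_add_distrib, Finset.mul_sum,
        inner_self_eq_norm_sq_to_K]
    rw [h2, Complex.add_re, Complex.ofReal_re]
    ring
  by_contra! hlt
  set a := (∑ i, ∑ j, inner ℂ (e i) (φ (c i j) (e j))).re
  set b := C * (∑ i, ∑ j, u i j * inner ℂ (e i) (e j)).re
  have hD : 0 ≤ C * ∑ i, ‖e i‖ ^ 2 := mul_nonneg hC (Finset.sum_nonneg fun _ _ => by positivity)
  set D := C * ∑ i, ‖e i‖ ^ 2
  -- With D the coefficient of ε, this choice keeps the error below half the supposed gap a - b; D +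
  -- 1 avoids division by zero.
  have h := key ((a - b) / (2 * (D + 1))) (div_pos (by linarith) (by linarith))
  have : (a - b) / (2 * (D + 1)) * D ≤ (a - b) / 2 := by
    rw [div_mul_eq_mul_div, div_le_div_iff₀ (by linarith) (by norm_num)]
    nlinarith
  linarith

end Functional

/-! ### Finitely supported matrices restricted to finite index families. -/

section Restriction

variable {ι A : Type*} [CStarAlgebra A]

/-- The restriction of a matrix with finite support to a finite family of indices. -/
def kernelRestrict {k : ℕ} (e : Fin k → ι) (x : ι × ι →₀ A) : CStarMatrix (Fin k) (Fin k) A :=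
  CStarMatrix.ofMatrix fun i j => x (e i, e j)

@[simp]
lemma kernelRestrict_apply {k : ℕ} (e : Fin k → ι) (x : ι × ι →₀ A) (i j : Fin k) :
    kernelRestrict e x i j = x (e i, e j) := rfl

lemma exists_injective_range_supset (s : Finset (ι × ι)) :
    ∃ (k : ℕ) (e : Fin k → ι), Function.Injective e ∧
      ∀ x ∈ s, x.1 ∈ Set.range e ∧ x.2 ∈ Set.range e := by
  classical
  set t := s.image Prod.fst ∪ s.image Prod.snd with ht
  refine ⟨t.card, fun i => (t.equivFin.symm i : ι),
    Subtype.val_injective.comp (Equiv.injective _), fun x hx => ⟨?_, ?_⟩⟩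
  · have : x.1 ∈ t := Finset.mem_union_left _ (Finset.mem_image_of_mem _ hx)
    exact ⟨t.equivFin ⟨x.1, this⟩, by simp⟩
  · have : x.2 ∈ t := Finset.mem_union_right _ (Finset.mem_image_of_mem _ hx)
    exact ⟨t.equivFin ⟨x.2, this⟩, by simp⟩

variable [PartialOrder A] [StarOrderedRing A]

/-- Placing r as the only nonzero row of a square matrix R exhibits the matrix as R*R. -/
lemma CStarMatrix.star_mul_nonneg {n : Type*} [Fintype n] [DecidableEq n] (r : n → A) :
    0 ≤ (CStarMatrix.ofMatrix fun i j => star (r i) * r j : CStarMatrix n n A) := by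
  rcases isEmpty_or_nonempty n with h | ⟨⟨i₀⟩⟩
  · exact le_of_eq (by ext i; exact isEmptyElim i)
  · have : (CStarMatrix.ofMatrix fun i j => star (r i) * r j : CStarMatrix n n A) =
        star (CStarMatrix.ofMatrix fun i j => if i = i₀ then r j else 0) *
          CStarMatrix.ofMatrix fun i j => if i = i₀ then r j else 0 := by
      ext i j
      change star (r i) * r j =
        ∑ x, star (if x = i₀ then r i else 0) * (if x = i₀ then r j else 0)
      simp
    rw [this]
    exact star_mul_self_nonneg _

lemma kernelRestrict_nonneg {k : ℕ} (e : Fin k → ι) {x : ι × ι →₀ A}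
    (hx : x ∈ squareCone ι A) : 0 ≤ kernelRestrict e x := by
  induction hx using AddSubmonoid.closure_induction with
  | mem x hx =>
    obtain ⟨v, rfl⟩ := hx
    exact CStarMatrix.star_mul_nonneg fun i => v (e i)
  | zero => exact le_of_eq (by ext; simp)
  | add x y _ _ hx hy =>
    have : kernelRestrict e (x + y) = kernelRestrict e x + kernelRestrict e y := by ext; simp
    exact this ▸ add_nonneg hx hy

lemma posSemidef_of_mem_squareCone {k : ℕ} (e : Fin k → ι) {x : ι × ι →₀ ℂ}
    (hx : x ∈ squareCone ι ℂ) :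
    (Matrix.of fun i j => x (e i, e j) : Matrix (Fin k) (Fin k) ℂ).PosSemidef := by
  induction hx using AddSubmonoid.closure_induction with
  | mem x hx =>
    obtain ⟨v, rfl⟩ := hx
    exact Matrix.posSemidef_vecMulVec_star_self (fun i => v (e i))
  | zero => exact Matrix.PosSemidef.zero
  | add x y _ _ hx hy => exact hx.add hy

end Restriction

/-! ### The functional of a map and its domination by Riesz extension. -/

section KernelFunctional

variable {A H : Type*} [CStarAlgebra A] [NormedAddCommGroup H] [InnerProductSpace ℂ H]

/-- The functional `x ↦ ∑ ⟪h, φ(x(h, k)) k⟫` on the matrices with finite support indexed by `H`. -/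
noncomputable def kernelFunctional (φ : A →ₗ[ℂ] H →L[ℂ] H) : (H × H →₀ A) →ₗ[ℂ] ℂ :=
  Finsupp.lsum ℂ fun x : H × H =>
    (innerₛₗ ℂ x.1) ∘ₗ (ContinuousLinearMap.apply ℂ H x.2).toLinearMap ∘ₗ φ

lemma kernelFunctional_single (φ : A →ₗ[ℂ] H →L[ℂ] H) (h k : H) (a : A) :
    kernelFunctional φ (Finsupp.single (h, k) a) = inner ℂ h (φ a k) := by
  simp [kernelFunctional]

lemma kernelFunctional_apply (φ : A →ₗ[ℂ] H →L[ℂ] H) (x : H × H →₀ A) :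
    kernelFunctional φ x = x.sum fun p a => inner ℂ p.1 (φ a p.2) := by
  simp [kernelFunctional, Finsupp.sum]

lemma kernelFunctional_eq_sum (φ : A →ₗ[ℂ] H →L[ℂ] H) (x : H × H →₀ A) {k : ℕ} {e : Fin k → H}
    (he : Function.Injective e)
    (hx : ∀ p ∈ x.support, p.1 ∈ Set.range e ∧ p.2 ∈ Set.range e) :
    kernelFunctional φ x = ∑ i, ∑ j, inner ℂ (e i) (φ (x (e i, e j)) (e j)) := by
  classical
  rw [kernelFunctional_apply, Finsupp.sum_of_support_subset x
    (s := Finset.univ.image (Prod.map e e)) _ _ (by simp),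
    Finset.sum_image (he.prodMap he).injOn, Fintype.sum_prod_type]
  · rfl
  · rintro ⟨p, q⟩ hp
    obtain ⟨⟨i, rfl⟩, ⟨j, rfl⟩⟩ := hx _ hp
    exact Finset.mem_image.mpr ⟨(i, j), Finset.mem_univ _, rfl⟩

/-- The functional `z ↦ ∑ z(h, k) ⟪h, k⟫`. -/
noncomputable def gramFunctional (H : Type*) [NormedAddCommGroup H] [InnerProductSpace ℂ H] :
    (H × H →₀ ℂ) →ₗ[ℂ] ℂ :=
  kernelFunctional (Algebra.linearMap ℂ (H →L[ℂ] H))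

lemma gramFunctional_outerProduct (w : H →₀ ℂ) :
    gramFunctional H (outerProduct w w) =
      ((‖Finsupp.linearCombination ℂ (id : H → H) w‖ ^ 2 : ℝ) : ℂ) := by
  have h : ∀ x : H, ((‖x‖ ^ 2 : ℝ) : ℂ) = inner ℂ x x := fun x => by
    rw [inner_self_eq_norm_sq_to_K]; norm_cast
  have hw : w = ∑ p ∈ w.support, Finsupp.single p (w p) := (Finsupp.sum_single w).symm
  rw [h, Finsupp.linearCombination_apply, Finsupp.sum]
  conv_lhs => rw [hw]
  rw [outerProduct_sum_sum, sum_inner, map_sum]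
  refine Finset.sum_congr rfl fun p _ => ?_
  rw [inner_sum, map_sum]
  refine Finset.sum_congr rfl fun q _ => ?_
  rw [outerProduct_single, gramFunctional, kernelFunctional_single]
  simp [Algebra.algebraMap_eq_smul_one, inner_smul_left, inner_smul_right]
  ring

lemma kernelFunctional_kernelAdjoint [CompleteSpace H] {φ : A →ₗ[ℂ] H →L[ℂ] H} (hφ : ∀ a, φ (star a) = star (φ a))
    (x : H × H →₀ A) :
    kernelFunctional φ (kernelAdjoint x) = starRingEnd ℂ (kernelFunctional φ x) := by
  induction x using Finsupp.induction_linear with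
  | zero => simp
  | add x y hx hy => rw [kernelAdjoint_add, map_add, hx, hy, map_add, map_add]
  | single pq a =>
    rw [kernelAdjoint_single, kernelFunctional_single, kernelFunctional_single, hφ,
      ContinuousLinearMap.star_eq_adjoint, ContinuousLinearMap.adjoint_inner_right,
      inner_conj_symm]

variable [PartialOrder A] [StarOrderedRing A]

/-- This is the positivity on the subspace that the Riesz extension needs. On an injective finite
enumeration of the vectors in the supports, y becomes a C*-matrix with 0 ≤ y ≤ z ⊗ 1, so the finite
estimate applies. -/
lemma re_kernelFunctional_le_gramFunctional {φ : A →ₗ[ℂ] H →L[ℂ] H} {C : ℝ} (hC : 0 ≤ C)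
    (hφ : IsFormBounded φ C) {x y : H × H →₀ A} {z : H × H →₀ ℂ} (hx : x ∈ squareCone H A)
    (hy : y ∈ squareCone H A) (hz : z ∈ squareCone H ℂ) (h : x + y = scalarKernel H A z) :
    (kernelFunctional φ y).re ≤ C * (gramFunctional H z).re := by
  classical
  obtain ⟨k, e, he, hs⟩ := exists_injective_range_supset (y.support ∪ z.support)
  rw [kernelFunctional_eq_sum φ y he fun p hp => hs p (Finset.mem_union_left _ hp),
    gramFunctional,
    kernelFunctional_eq_sum _ z he fun p hp => hs p (Finset.mem_union_right _ hp)]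
  have hle : kernelRestrict e y ≤ CStarMatrix.ofMatrix
      ((Matrix.of fun i j => z (e i, e j) : Matrix (Fin k) (Fin k) ℂ).map (algebraMap ℂ A)) := by
    have : CStarMatrix.ofMatrix
        ((Matrix.of fun i j => z (e i, e j) : Matrix (Fin k) (Fin k) ℂ).map (algebraMap ℂ A)) =
        kernelRestrict e x + kernelRestrict e y := by
      ext i j
      simp [← scalarKernel_apply, ← h]
    rw [this]
    exact le_add_of_nonneg_left (kernelRestrict_nonneg e hx)
  refine (re_sum_inner_le_of_le_posSemidef hC hφ (kernelRestrict_nonneg e hy)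
    (posSemidef_of_mem_squareCone e hz) hle e).trans (le_of_eq ?_)
  simp [Algebra.algebraMap_eq_smul_one]

/-- The functional on matrices with finite support that dominates a completely bounded map. -/
theorem exists_dominating_functional [CompleteSpace H] {φ : A →ₗ[ℂ] H →L[ℂ] H} {C : ℝ} (hC : 0 ≤ C)
    (hφ : IsFormBounded φ C) (hherm : ∀ a, φ (star a) = star (φ a)) :
    ∃ f : (H × H →₀ A) →ₗ[ℝ] ℝ,
      (∀ v : H →₀ A, 0 ≤ f (outerProduct v v)) ∧
      (∀ v : H →₀ A, (kernelFunctional φ (outerProduct v v)).re ≤ f (outerProduct v v)) ∧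
      (∀ w : H →₀ ℂ, f (scalarKernel H A (outerProduct w w)) ≤
        C * ‖Finsupp.linearCombination ℂ (id : H → H) w‖ ^ 2) ∧
      ∀ x, x + kernelAdjoint x = 0 → f x = 0 := by
  let g : (H × H →₀ A) →ₗ[ℝ] ℝ := Complex.reLm ∘ₗ (kernelFunctional φ).restrictScalars ℝ
  let τ : (H × H →₀ ℂ) →ₗ[ℝ] ℝ := Complex.reLm ∘ₗ (gramFunctional H).restrictScalars ℝ
  have hg : ∀ x, g x = (kernelFunctional φ x).re := fun x => rfl
  have hτ : ∀ z, τ z = (gramFunctional H z).re := fun z => rfl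
  have hg' : ∀ x, g (x + kernelAdjoint x) = 2 * g x := fun x => by
    rw [map_add, hg (kernelAdjoint x), kernelFunctional_kernelAdjoint hherm, Complex.conj_re, hg]
    ring
  have hτ' : ∀ z, τ (z + kernelAdjoint z) = 2 * τ z := fun z => by
    rw [map_add, hτ (kernelAdjoint z), gramFunctional, kernelFunctional_kernelAdjoint,
      Complex.conj_re, hτ, gramFunctional]
    · ring
    · intro a
      exact algebraMap_star_comm a
  let T : (H × H →₀ ℂ) →ₗ[ℝ] (H × H →₀ A) := (scalarKernel H A).restrictScalars ℝ
  have hT : ∀ z, T z = scalarKernel H A z := fun z => rfl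
  -- The kernel of `L` is the set of triples with x + y = T z. A functional extended from it to all
  -- triples is then split into its values on the three summands, the first of which is the
  -- functional sought.
  let L : ((H × H →₀ A) × (H × H →₀ A) × (H × H →₀ ℂ)) →ₗ[ℝ] (H × H →₀ A) :=
    LinearMap.coprod LinearMap.id (LinearMap.coprod LinearMap.id (-T))
  have hL : ∀ x y z, L (x, y, z) = x + (y - T z) := fun x y z => by simp [L, sub_eq_add_neg]
  let D : Submodule ℝ
      ((H × H →₀ A) × (H × H →₀ A) × (H × H →₀ ℂ)) := LinearMap.ker L
  have hD : ∀ x y z, (x, y, z) ∈ D ↔ x + y = T z := fun x y z => by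
    rw [LinearMap.mem_ker, hL, ← add_sub_assoc, sub_eq_zero]
  let F₀ : ((H × H →₀ A) × (H × H →₀ A) × (H × H →₀ ℂ)) →ₗ[ℝ] ℝ := LinearMap.coprod 0 (LinearMap.coprod (-g) (C • τ))
  have hF₀ : ∀ x y z, F₀ (x, y, z) = -g y + C * τ z := fun x y z => by simp [F₀]
  -- Sums of squares span only Hermitian matrices. Asking this of the Hermitian part alone puts all
  -- skew matrices into the cone, so that cone plus subspace is the whole real space, as the
  -- extension theorem requires.
  let s : PointedCone ℝ ((H × H →₀ A) × (H × H →₀ A) × (H × H →₀ ℂ)) :=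
    (accretiveCone H A).prod ((accretiveCone H A).prod (accretiveCone H ℂ))
  have hs : ∀ x y z, (x, y, z) ∈ s ↔
      x ∈ accretiveCone H A ∧ y ∈ accretiveCone H A ∧ z ∈ accretiveCone H ℂ :=
    fun x y z => Iff.rfl
  obtain ⟨F, hFD, hFs⟩ := riesz_extension s (F₀.toPMap D)
    (by
      rintro ⟨⟨x, y, z⟩, hxyz⟩ hmem
      replace hxyz := (hD x y z).mp hxyz
      obtain ⟨hx, hy, hz⟩ := (hs x y z).mp hmem
      change 0 ≤ F₀ (x, y, z)
      have hsum : x + kernelAdjoint x + (y + kernelAdjoint y) =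
          scalarKernel H A (z + kernelAdjoint z) := by
        rw [map_add, scalarKernel_kernelAdjoint, ← hT, ← hxyz, kernelAdjoint_add]
        abel
      have := re_kernelFunctional_le_gramFunctional hC hφ (mem_accretiveCone.mp hx)
        (mem_accretiveCone.mp hy) (mem_accretiveCone.mp hz) hsum
      rw [← hg, hg', ← hτ, hτ'] at this
      rw [hF₀]
      linarith)
    (by
      rintro ⟨x, y, z⟩
      obtain ⟨r₁, h₁, hx⟩ := exists_scalarKernel_add_mem_accretiveCone x
      obtain ⟨r₂, h₂, hy⟩ := exists_scalarKernel_add_mem_accretiveCone y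
      obtain ⟨r₃, h₃, hz⟩ := exists_scalarKernel_add_mem_accretiveCone z
      have hr₃ : scalarKernel H ℂ r₃ = r₃ := by ext; simp
      -- The correction must lie in `D`: r₁, r₂, r₃ all enter the scalar component, and the r₃
      -- absorbing z is balanced in the first component, where it does no harm since its image is in
      -- the cone.
      refine ⟨⟨(T (r₁ + r₃), T r₂, r₁ + r₂ + r₃), ?_⟩, ?_⟩
      · exact (hD _ _ _).mpr (by rw [← map_add, add_right_comm])
      · refine (hs _ _ _).mpr ⟨?_, hy, ?_⟩
        · change T (r₁ + r₃) + x ∈ _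
          rw [map_add, add_right_comm]
          exact add_mem hx (scalarKernel_mem_accretiveCone h₃)
        · rw [hr₃] at hz
          change r₁ + r₂ + r₃ + z ∈ _
          rw [add_assoc]
          exact add_mem (add_mem h₁ h₂) hz)
  replace hFD : ∀ x y z, x + y = T z → F (x, y, z) = -g y + C * τ z := fun x y z h =>
    (hFD ⟨(x, y, z), (hD x y z).mpr h⟩).trans (hF₀ x y z)
  refine ⟨F ∘ₗ LinearMap.inl ℝ _ _, fun v => ?_, fun v => ?_, fun w => ?_, fun x hx => ?_⟩
  · exact hFs _ ((hs _ _ _).mpr ⟨squareCone_le_accretiveCone (outerProduct_mem_squareCone v),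
      zero_mem _, zero_mem _⟩)
  · set c := outerProduct v v
    have h1 : 0 ≤ F (0, c, 0) := hFs _ ((hs _ _ _).mpr
      ⟨zero_mem _, squareCone_le_accretiveCone (outerProduct_mem_squareCone v), zero_mem _⟩)
    -- The triple (-c, c, 0) lies in `D`, so positivity at (0, c, 0) says that f(c) - g(c) ≥ 0.
    have h2 := hFD (-c) c 0 (by simp)
    have h3 : ((-c, c, 0) : (H × H →₀ A) × (H × H →₀ A) × (H × H →₀ ℂ)) = (0, c, 0) - (c, 0, 0) := by simp
    rw [h3, map_sub] at h2
    change _ ≤ F (c, 0, 0)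
    rw [← hg]
    simp only [map_zero, mul_zero, add_zero] at h2
    linarith
  · set u := outerProduct w w with hu
    have h1 : 0 ≤ F (0, 0, u) := hFs _ ((hs _ _ _).mpr
      ⟨zero_mem _, zero_mem _, squareCone_le_accretiveCone (outerProduct_mem_squareCone w)⟩)
    -- The triple (T u, 0, u) lies in `D` with value C τ(u), so positivity at (0, 0, u) bounds f(T
    -- u).
    have h2 := hFD (T u) 0 u (by simp)
    have h3 : ((T u, 0, u) : (H × H →₀ A) × (H × H →₀ A) × (H × H →₀ ℂ)) = (T u, 0, 0) + (0, 0, u) := by simp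
    have h4 : τ u = ‖Finsupp.linearCombination ℂ (id : H → H) w‖ ^ 2 := by
      rw [hτ, hu, gramFunctional_outerProduct, Complex.ofReal_re]
    rw [h3, map_add, h4] at h2
    change F (T u, 0, 0) ≤ _
    simp only [map_zero, neg_zero, zero_add] at h2
    linarith
  · have hx' : (-x) + kernelAdjoint (-x) = 0 := by
      rw [kernelAdjoint_neg, ← neg_add, hx, neg_zero]
    have h1 : 0 ≤ F (x, 0, 0) := hFs _ ((hs _ _ _).mpr
      ⟨mem_accretiveCone.mpr (hx ▸ zero_mem _), zero_mem _, zero_mem _⟩)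
    have h2 : 0 ≤ F (-x, 0, 0) := hFs _ ((hs _ _ _).mpr
      ⟨mem_accretiveCone.mpr (hx' ▸ zero_mem _), zero_mem _, zero_mem _⟩)
    have h3 : ((-x, 0, 0) : (H × H →₀ A) × (H × H →₀ A) × (H × H →₀ ℂ)) = -(x, 0, 0) := by simp
    rw [h3, map_neg] at h2
    change F (x, 0, 0) = 0
    linarith

end KernelFunctional

/-! ### From positive functionals back to operator-valued maps. -/

section Representation

variable {A H : Type*} [CStarAlgebra A] [NormedAddCommGroup H] [InnerProductSpace ℂ H]

/-- Cauchy–Schwarz for the semi-inner product (v, w) ↦ F(v*w). -/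
lemma norm_sq_apply_outerProduct_le {ι : Type*} {F : (ι × ι →₀ A) →ₗ[ℂ] ℂ}
    (hpos : ∀ v : ι →₀ A, 0 ≤ F (outerProduct v v))
    (hherm : ∀ x, F (kernelAdjoint x) = starRingEnd ℂ (F x)) (v w : ι →₀ A) :
    ‖F (outerProduct v w)‖ ^ 2 ≤ (F (outerProduct v v)).re * (F (outerProduct w w)).re := by
  let core : PreInnerProductSpace.Core ℂ (ι →₀ A) :=
    { inner := fun v w => F (outerProduct v w)
      conj_inner_symm := fun v w => by
        change starRingEnd ℂ (F (outerProduct w v)) = F (outerProduct v w)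
        rw [← hherm, kernelAdjoint_outerProduct]
      re_inner_nonneg := fun v => (Complex.nonneg_iff.mp (hpos v)).1
      add_left := fun u v w => by
        change F _ = F _ + F _
        rw [outerProduct_add_left, map_add]
      smul_left := fun v w r => by
        change F _ = _ * F _
        have : outerProduct (r • v) w = starRingEnd ℂ r • outerProduct v w := by
          ext x; simp
        rw [this, map_smul, smul_eq_mul] }
  have h := @InnerProductSpace.Core.inner_mul_inner_self_le ℂ (ι →₀ A) _ _ _ core v w
  change ‖F (outerProduct v w)‖ * ‖F (outerProduct w v)‖ ≤ _ at h
  have hs : F (outerProduct w v) = starRingEnd ℂ (F (outerProduct v w)) := by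
    rw [← hherm, kernelAdjoint_outerProduct]
  rw [hs, RCLike.norm_conj, ← sq] at h
  exact h

/-- Complete positivity in terms of the sesquilinear forms of the amplifications. -/
def IsFormPositive (φ : A →ₗ[ℂ] H →L[ℂ] H) : Prop :=
  ∀ (n : ℕ) (a : Fin n → A) (h : Fin n → H),
    0 ≤ ∑ i, ∑ j, inner ℂ (h i) (φ (star (a i) * a j) (h j))

variable [PartialOrder A] [StarOrderedRing A]

lemma re_apply_single_star_mul_le {F : (H × H →₀ A) →ₗ[ℂ] ℂ} {C : ℝ}
    (hpos : ∀ v : H →₀ A, 0 ≤ F (outerProduct v v))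
    (hbdd : ∀ w : H →₀ ℂ, (F (scalarKernel H A (outerProduct w w))).re ≤
      C * ‖Finsupp.linearCombination ℂ (id : H → H) w‖ ^ 2) (k : H) (a : A) :
    (F (Finsupp.single (k, k) (star a * a))).re ≤ ‖a‖ ^ 2 * (C * ‖k‖ ^ 2) := by
  obtain ⟨b, hb⟩ := CStarAlgebra.nonneg_iff_eq_star_mul_self.mp
    (sub_nonneg.mpr (CStarAlgebra.star_mul_le_algebraMap_norm_sq (a := a)))
  have h1 := hbdd (Finsupp.single k 1)
  have h2 : scalarKernel H A (outerProduct (Finsupp.single k 1) (Finsupp.single k 1)) =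
      Finsupp.single (k, k) 1 := by
    simp [scalarKernel]
  rw [h2] at h1
  simp only [Finsupp.linearCombination_single, id, one_smul] at h1
  have h3 := (Complex.nonneg_iff.mp (hpos (Finsupp.single k b))).1
  have h4 : (Finsupp.single (k, k) (algebraMap ℝ A (‖a‖ ^ 2)) : H × H →₀ A) =
      ((‖a‖ ^ 2 : ℝ) : ℂ) • Finsupp.single (k, k) 1 := by
    rw [Finsupp.smul_single, Algebra.algebraMap_eq_smul_one, Complex.coe_smul]
  rw [outerProduct_single, ← hb, Finsupp.single_sub, map_sub, h4, map_smul, Complex.sub_re,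
    smul_eq_mul, Complex.re_ofReal_mul] at h3
  nlinarith [sq_nonneg ‖a‖]

/-- Cauchy–Schwarz with a scalar first vector, which the hypothesis on scalar squares controls by
the norm of the combination formed in H; the second factor is controlled through a*a ≤ ‖a‖². -/
lemma norm_sum_apply_single_le {F : (H × H →₀ A) →ₗ[ℂ] ℂ} {C : ℝ} (hC : 0 ≤ C)
    (hpos : ∀ v : H →₀ A, 0 ≤ F (outerProduct v v))
    (hherm : ∀ x, F (kernelAdjoint x) = starRingEnd ℂ (F x))
    (hbdd : ∀ w : H →₀ ℂ, (F (scalarKernel H A (outerProduct w w))).re ≤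
      C * ‖Finsupp.linearCombination ℂ (id : H → H) w‖ ^ 2) (w : H →₀ ℂ) (k : H) (a : A) :
    ‖w.sum fun h c => starRingEnd ℂ c * F (Finsupp.single (h, k) a)‖ ≤
      C * ‖a‖ * ‖Finsupp.linearCombination ℂ (id : H → H) w‖ * ‖k‖ := by
  set w' : H →₀ A := w.mapRange (algebraMap ℂ A) (map_zero _) with hw'
  have h1 : (w.sum fun h c => starRingEnd ℂ c * F (Finsupp.single (h, k) a)) =
      F (outerProduct w' (Finsupp.single k a)) := by
    have hsum : ∀ h c, starRingEnd ℂ c * F (Finsupp.single (h, k) a) =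
        F (outerProduct (Finsupp.single h (algebraMap ℂ A c)) (Finsupp.single k a)) := by
      intro h c
      rw [outerProduct_single, ← algebraMap_star_comm, ← Algebra.smul_def, ← Finsupp.smul_single,
        map_smul, smul_eq_mul, starRingEnd_apply]
    simp only [hsum]
    rw [hw']
    clear hw' w'
    induction w using Finsupp.induction_linear with
    | zero => simp [show outerProduct (0 : H →₀ A) (Finsupp.single k a) = 0 by ext; simp]
    | add u v hu hv =>
      rw [Finsupp.sum_add_index', hu, hv, Finsupp.mapRange_add (map_add _),
        outerProduct_add_left, map_add]
      · intro h
        simp [show outerProduct (0 : H →₀ A) (Finsupp.single k a) = 0 by ext; simp]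
      · intro h c c'
        rw [map_add, Finsupp.single_add, outerProduct_add_left, map_add]
    | single h c =>
      rw [Finsupp.sum_single_index, Finsupp.mapRange_single]
      simp [show outerProduct (0 : H →₀ A) (Finsupp.single k a) = 0 by ext; simp]
  have h2 := norm_sq_apply_outerProduct_le hpos hherm w' (Finsupp.single k a)
  have h3 : (F (outerProduct w' w')).re ≤
      C * ‖Finsupp.linearCombination ℂ (id : H → H) w‖ ^ 2 := by
    rw [hw', ← scalarKernel_outerProduct]
    exact hbdd w
  have h4 := re_apply_single_star_mul_le hpos hbdd k a
  rw [← outerProduct_single] at h4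
  have h5 := (Complex.nonneg_iff.mp (hpos (Finsupp.single k a))).1
  rw [h1]
  refine abs_le_of_sq_le_sq' ?_ (by positivity) |>.2
  calc ‖F (outerProduct w' (Finsupp.single k a))‖ ^ 2
      ≤ C * ‖Finsupp.linearCombination ℂ (id : H → H) w‖ ^ 2 * (‖a‖ ^ 2 * (C * ‖k‖ ^ 2)) :=
        h2.trans (mul_le_mul h3 h4 h5 (by positivity))
    _ = _ := by ring

/-- A bounded positive functional on matrices with finite support indexed by `H` comes from a
linear map into the bounded operators on `H`. -/
theorem exists_linearMap_of_functional [CompleteSpace H] {F : (H × H →₀ A) →ₗ[ℂ] ℂ} {C : ℝ}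
    (hC : 0 ≤ C) (hpos : ∀ v : H →₀ A, 0 ≤ F (outerProduct v v))
    (hherm : ∀ x, F (kernelAdjoint x) = starRingEnd ℂ (F x))
    (hbdd : ∀ w : H →₀ ℂ, (F (scalarKernel H A (outerProduct w w))).re ≤
      C * ‖Finsupp.linearCombination ℂ (id : H → H) w‖ ^ 2) :
    ∃ ψ : A →ₗ[ℂ] H →L[ℂ] H, ∀ a h k, inner ℂ h (ψ a k) = F (Finsupp.single (h, k) a) := by
  have hsymm : ∀ a h k, F (Finsupp.single (h, k) a) =
      starRingEnd ℂ (F (Finsupp.single (k, h) (star a))) := fun a h k => by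
    rw [← hherm, kernelAdjoint_single, star_star]
  -- Vectors of H serve as free indices, so sesquilinearity in them is not automatic. The bound
  -- forces every linear relation in H to hold for F; it is used for e_{h+h'} - e_h - e_{h'} and
  -- e_{ch} - c e_h.
  have hB : ∀ (w : H →₀ ℂ) (k : H) (a : A), Finsupp.linearCombination ℂ (id : H → H) w = 0 →
      (w.sum fun h c => starRingEnd ℂ c * F (Finsupp.single (h, k) a)) = 0 := fun w k a hw => by
    have := norm_sum_apply_single_le hC hpos hherm hbdd w k a
    rw [hw, norm_zero, mul_zero, zero_mul] at this
    exact norm_le_zero_iff.mp this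
  have hadd : ∀ a h h' k, F (Finsupp.single (h + h', k) a) =
      F (Finsupp.single (h, k) a) + F (Finsupp.single (h', k) a) := fun a h h' k => by
    have := hB (Finsupp.single (h + h') 1 - Finsupp.single h 1 - Finsupp.single h' 1) k a
      (by simp)
    rw [Finsupp.sum_sub_index, Finsupp.sum_sub_index] at this
    · simp only [Finsupp.sum_single_index, map_zero, zero_mul, map_one, one_mul] at this
      linear_combination this
    all_goals intros; rw [map_sub, sub_mul]
  have hsmul : ∀ a (c : ℂ) h k, F (Finsupp.single (c • h, k) a) =
      starRingEnd ℂ c * F (Finsupp.single (h, k) a) := fun a c h k => by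
    have := hB (Finsupp.single (c • h) 1 - Finsupp.single h c) k a (by simp)
    rw [Finsupp.sum_sub_index] at this
    · simp only [Finsupp.sum_single_index, map_zero, zero_mul, map_one, one_mul] at this
      linear_combination this
    all_goals intros; rw [map_sub, sub_mul]
  have hadd' : ∀ a h k k', F (Finsupp.single (h, k + k') a) =
      F (Finsupp.single (h, k) a) + F (Finsupp.single (h, k') a) := fun a h k k' => by
    rw [hsymm, hadd, map_add, ← hsymm, ← hsymm]
  have hsmul' : ∀ a (c : ℂ) h k, F (Finsupp.single (h, c • k) a) =
      c * F (Finsupp.single (h, k) a) := fun a c h k => by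
    rw [hsymm, hsmul, map_mul, Complex.conj_conj, ← hsymm]
  have hnorm : ∀ a h k, ‖F (Finsupp.single (h, k) a)‖ ≤ C * ‖a‖ * ‖h‖ * ‖k‖ := fun a h k => by
    have := norm_sum_apply_single_le hC hpos hherm hbdd (Finsupp.single h 1) k a
    simpa [Finsupp.sum_single_index] using this
  let B : A → H →L⋆[ℂ] H →L[ℂ] ℂ := fun a =>
    LinearMap.mkContinuous₂ (LinearMap.mk₂'ₛₗ (starRingEnd ℂ) (RingHom.id ℂ)
      (fun h k => F (Finsupp.single (h, k) a)) (hadd a) (fun c h k => hsmul a c h k)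
      (hadd' a) (fun c h k => hsmul' a c h k)) (C * ‖a‖) (hnorm a)
  have hBa : ∀ a h k, B a h k = F (Finsupp.single (h, k) a) := fun a h k => rfl
  let ψ : A → H →L[ℂ] H := fun a =>
    ContinuousLinearMap.adjoint (InnerProductSpace.continuousLinearMapOfBilin (B a))
  have hψ : ∀ a h k, inner ℂ h (ψ a k) = F (Finsupp.single (h, k) a) := fun a h k => by
    rw [ContinuousLinearMap.adjoint_inner_right,
      InnerProductSpace.continuousLinearMapOfBilin_apply, hBa]
  refine ⟨{ toFun := ψ, map_add' := fun a b => ?_, map_smul' := fun c a => ?_ }, hψ⟩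
  · ext k
    refine ext_inner_left ℂ fun h => ?_
    rw [hψ, add_apply, inner_add_right, hψ, hψ, Finsupp.single_add, map_add]
  · ext k
    refine ext_inner_left ℂ fun h => ?_
    rw [hψ, smul_apply, inner_smul_right, hψ, ← Finsupp.smul_single, map_smul]
    rfl

/-- **Wittstock decomposition**: a completely bounded Hermitian map into the bounded operators on a
Hilbert space is dominated by a completely positive map. -/
theorem exists_isFormPositive_sub [CompleteSpace H] {φ : A →ₗ[ℂ] H →L[ℂ] H} {C : ℝ}
    (hC : 0 ≤ C) (hφ : IsFormBounded φ C) (hherm : ∀ a, φ (star a) = star (φ a)) :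
    ∃ ψ : A →ₗ[ℂ] H →L[ℂ] H, IsFormPositive ψ ∧ IsFormPositive (ψ - φ) := by
  obtain ⟨f, hf0, hfφ, hfC, hfskew⟩ := exists_dominating_functional hC hφ hherm
  let F : (H × H →₀ A) →ₗ[ℂ] ℂ := Module.Dual.extendRCLike f
  have hre : ∀ x, (F x).re = f x := fun x => Module.Dual.re_extendRCLike_apply (𝕜 := ℂ) f x
  have him : ∀ x, (F x).im = -f (Complex.I • x) := fun x =>
    Module.Dual.im_extendRCLike_apply (𝕜 := ℂ) f x
  -- Since f kills skew matrices it is invariant under the adjoint; hence its complex extension is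
  -- Hermitian and real on squares.
  have hadj : ∀ x, f (kernelAdjoint x) = f x := fun x => by
    have hinv : kernelAdjoint (kernelAdjoint x) = x := by ext ⟨p, q⟩; simp
    have := hfskew (x - kernelAdjoint x) (by
      rw [sub_eq_add_neg, kernelAdjoint_add, kernelAdjoint_neg, hinv]; abel)
    rw [map_sub] at this
    linarith
  have hFherm : ∀ x, F (kernelAdjoint x) = starRingEnd ℂ (F x) := fun x => by
    refine Complex.ext ?_ ?_
    · rw [Complex.conj_re, hre, hre, hadj]
    · have : Complex.I • kernelAdjoint x = -kernelAdjoint (Complex.I • x) := by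
        rw [kernelAdjoint_smul]
        simp
      rw [Complex.conj_im, him, him, this, map_neg, hadj]
  have hFpos : ∀ v : H →₀ A, 0 ≤ F (outerProduct v v) := fun v => by
    refine Complex.nonneg_iff.mpr ⟨(hre _).symm ▸ hf0 v, ?_⟩
    have h := congrArg Complex.im (hFherm (outerProduct v v))
    rw [kernelAdjoint_outerProduct, Complex.conj_im] at h
    linarith
  obtain ⟨ψ, hψ⟩ := exists_linearMap_of_functional hC hFpos hFherm
    (fun w => (hre _).symm ▸ hfC w)
  have hsum : ∀ (n : ℕ) (a : Fin n → A) (h : Fin n → H) (G : (H × H →₀ A) →ₗ[ℂ] ℂ),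
      ∑ i, ∑ j, G (Finsupp.single (h i, h j) (star (a i) * a j)) =
        G (outerProduct (∑ i, Finsupp.single (h i) (a i)) (∑ i, Finsupp.single (h i) (a i))) := by
    intro n a h G
    rw [outerProduct_sum_sum, map_sum]
    simp only [map_sum, outerProduct_single]
  refine ⟨ψ, fun n a h => ?_, fun n a h => ?_⟩
  · simp only [hψ, hsum]
    exact hFpos _
  · simp only [LinearMap.sub_apply, sub_apply, inner_sub_right, hψ, ← kernelFunctional_single,
      Finset.sum_sub_distrib, hsum]
    set v := ∑ i, Finsupp.single (h i) (a i)
    have h1 := kernelFunctional_kernelAdjoint hherm (outerProduct v v)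
    rw [kernelAdjoint_outerProduct] at h1
    have h2 := congrArg Complex.im h1
    rw [Complex.conj_im] at h2
    refine Complex.nonneg_iff.mpr ⟨?_, ?_⟩
    · rw [Complex.sub_re, hre]
      linarith [hfφ v]
    · rw [Complex.sub_im, ← (Complex.nonneg_iff.mp (hFpos v)).2]
      linarith

end Representation

/-! ### Norms of matrices over C*-algebras -/

section MatrixNorm

variable {A : Type*} [CStarAlgebra A] [PartialOrder A] [StarOrderedRing A]

open CStarMatrix WithCStarModule

/-- Such a matrix sees only the coordinates (p, b) of a row and writes only to the coordinates (q,
c), and passing to part of a row does not increase its norm. -/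
lemma norm_comp_single_le {m n : Type*} [Fintype m] [Fintype n] [DecidableEq m] [DecidableEq n]
    {k : ℕ} (d : CStarMatrix (Fin k) (Fin k) A) (b : m) (c : n) :
    ‖CStarMatrix.ofMatrix (Matrix.comp (Fin k) (Fin k) m n A
      (Matrix.of fun p q => Matrix.single b c (d p q)))‖ ≤ ‖d‖ := by
  rw [norm_def]
  refine ContinuousLinearMap.opNorm_le_bound _ (norm_nonneg d) fun v => ?_
  set M := CStarMatrix.ofMatrix (Matrix.comp (Fin k) (Fin k) m n A
      (Matrix.of fun p q => Matrix.single b c (d p q))) with hM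
  let w : C⋆ᵐᵒᵈ(A, Fin k → A) := (equiv A (Fin k → A)).symm fun p => v (p, b)
  have hMapp : ∀ p q, M p q = if b = p.2 ∧ c = q.2 then d p.1 q.1 else 0 := fun p q => rfl
  have hMv : ∀ q, toCLM M v q = if c = q.2 then toCLM d w q.1 else 0 := fun q => by
    rw [toCLM_apply_eq_sum, toCLM_apply_eq_sum]
    change ∑ p, v p * M p q = if c = q.2 then ∑ p, v (p, b) * d p q.1 else 0
    simp only [hMapp, Fintype.sum_prod_type]
    by_cases hq : c = q.2 <;> simp [hq]
  have h1 : ‖toCLM M v‖ = ‖toCLM d w‖ := by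
    rw [pi_norm, pi_norm]
    congr 2
    rw [Fintype.sum_prod_type]
    refine Finset.sum_congr rfl fun q _ => ?_
    rw [Finset.sum_eq_single c]
    · rw [hMv]; simp
    · intro c' _ hc'
      rw [hMv, if_neg (Ne.symm hc')]; simp
    · simp
  have h2 : ‖w‖ ≤ ‖v‖ := by
    rw [pi_norm, pi_norm]
    refine Real.sqrt_le_sqrt ?_
    refine CStarAlgebra.norm_le_norm_of_nonneg_of_le
      (Finset.sum_nonneg fun _ _ => CStarModule.inner_self_nonneg) ?_
    rw [Fintype.sum_prod_type]
    refine Finset.sum_le_sum fun p _ => ?_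
    change inner A (v (p, b)) (v (p, b)) ≤ _
    exact Finset.single_le_sum (f := fun y => inner A (v (p, y)) (v (p, y)))
      (fun _ _ => CStarModule.inner_self_nonneg) (Finset.mem_univ b)
  rw [h1]
  exact ((toCLM d).le_opNorm w).trans (mul_le_mul_of_nonneg_left h2 (norm_nonneg _))

variable {Y : Type*} [NormedAddCommGroup Y] [InnerProductSpace ℂ Y] [CompleteSpace Y]

/-- A fixed unit vector ξ embeds tuples of vectors isometrically into rows of operators. This links
the C*-module definition of the norm of a matrix to Hilbert space estimates. -/
lemma norm_rankOne_row {m : Type*} [Fintype m] {ξ : Y} (hξ : ‖ξ‖ = 1) (x : m → Y) :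
    ‖((equiv (Y →L[ℂ] Y) (m → Y →L[ℂ] Y)).symm fun i => InnerProductSpace.rankOne ℂ ξ (x i) :
      C⋆ᵐᵒᵈ(Y →L[ℂ] Y, m → Y →L[ℂ] Y))‖ = √(∑ i, ‖x i‖ ^ 2) := by
  rw [pi_norm]
  congr 1
  have : ∀ i, inner (Y →L[ℂ] Y) (InnerProductSpace.rankOne ℂ ξ (x i))
      (InnerProductSpace.rankOne ℂ ξ (x i)) =
      ((‖x i‖ ^ 2 : ℝ) : ℂ) • InnerProductSpace.rankOne ℂ ξ ξ := fun i => by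
    rw [inner_def, ContinuousLinearMap.star_eq_adjoint, InnerProductSpace.adjoint_rankOne,
      ContinuousLinearMap.mul_def, InnerProductSpace.rankOne_comp_rankOne,
      inner_self_eq_norm_sq_to_K]
    norm_cast
  simp only [equiv_symm_pi_apply, this]
  rw [← Finset.sum_smul, norm_smul, InnerProductSpace.norm_rankOne, hξ, ← Complex.ofReal_sum,
    Complex.norm_real, Real.norm_of_nonneg (Finset.sum_nonneg fun _ _ => by positivity)]
  ring

lemma norm_sum_inner_le {m n : Type*} [Fintype m] [Fintype n] (T : CStarMatrix m n (Y →L[ℂ] Y))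
    (x : m → Y) (y : n → Y) :
    ‖∑ i, ∑ j, inner ℂ (x i) (T i j (y j))‖ ≤
      ‖T‖ * √(∑ i, ‖x i‖ ^ 2) * √(∑ j, ‖y j‖ ^ 2) := by
  rcases subsingleton_or_nontrivial Y with hY | hY
  · have : ∀ i j, inner ℂ (x i) (T i j (y j)) = (0 : ℂ) := fun i j => by
      rw [Subsingleton.elim (x i) 0, inner_zero_left]
    simp only [this, Finset.sum_const_zero, norm_zero]
    positivity
  · obtain ⟨ξ, hξ⟩ := exists_norm_eq Y zero_le_one
    let v : C⋆ᵐᵒᵈ(Y →L[ℂ] Y, m → Y →L[ℂ] Y) :=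
      (equiv _ _).symm fun i => InnerProductSpace.rankOne ℂ ξ (x i)
    let w : C⋆ᵐᵒᵈ(Y →L[ℂ] Y, n → Y →L[ℂ] Y) :=
      (equiv _ _).symm fun i => InnerProductSpace.rankOne ℂ ξ (y i)
    have h1 : inner (Y →L[ℂ] Y) w (toCLM T v) =
        (∑ i, ∑ j, inner ℂ (x i) (T i j (y j))) • InnerProductSpace.rankOne ℂ ξ ξ := by
      rw [pi_inner, Finset.sum_comm, Finset.sum_smul]
      refine Finset.sum_congr rfl fun j _ => ?_
      rw [toCLM_apply_eq_sum, inner_def]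
      change (∑ i, InnerProductSpace.rankOne ℂ ξ (x i) * T i j) *
        star (InnerProductSpace.rankOne ℂ ξ (y j)) = _
      rw [Finset.sum_mul, Finset.sum_smul]
      refine Finset.sum_congr rfl fun i _ => ?_
      rw [ContinuousLinearMap.star_eq_adjoint, InnerProductSpace.adjoint_rankOne, mul_assoc,
        ContinuousLinearMap.mul_def (T i j), InnerProductSpace.comp_rankOne,
        ContinuousLinearMap.mul_def, InnerProductSpace.rankOne_comp_rankOne]
    have h2 : ‖inner (Y →L[ℂ] Y) w (toCLM T v)‖ ≤ ‖w‖ * ‖toCLM T v‖ :=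
      CStarModule.norm_inner_le _
    rw [h1, norm_smul, InnerProductSpace.norm_rankOne, hξ, mul_one, mul_one] at h2
    refine h2.trans ?_
    rw [norm_rankOne_row hξ, mul_comm]
    refine mul_le_mul_of_nonneg_right ?_ (Real.sqrt_nonneg _)
    refine ((toCLM T).le_opNorm v).trans ?_
    rw [norm_rankOne_row hξ]
    exact le_rfl

/-- Uniform boundedness of the amplifications of the entries of `φ`. -/
def IsEntrywiseBounded {m n : Type*} [DecidableEq m] [DecidableEq n]
    (φ : Matrix m n A →ₗ[ℂ] Matrix m n (Y →L[ℂ] Y)) : Prop :=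
  ∃ C, 0 ≤ C ∧ ∀ (a b : m) (c d : n) (k : ℕ) (D : CStarMatrix (Fin k) (Fin k) A) (x y : Fin k → Y),
    ‖∑ i, ∑ j, inner ℂ (x i) (φ (Matrix.single b d (D i j)) a c (y j))‖ ≤
      C * ‖D‖ * (∑ i, ‖x i‖ ^ 2 + ∑ i, ‖y i‖ ^ 2)

/-- Test vectors supported at the coordinates a and c isolate one entry. The product of norms is
relaxed to a sum of squares, a form that adds up over all pairs of entries. -/
lemma IsCompletelyBounded.isEntrywiseBounded {m n : Type*} [Fintype m] [Fintype n]
    [DecidableEq m] [DecidableEq n] {φ : Matrix m n A →ₗ[ℂ] Matrix m n (Y →L[ℂ] Y)}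
    (hφ : IsCompletelyBounded φ) :
    IsEntrywiseBounded φ := by
  obtain ⟨C, hC⟩ := hφ
  refine ⟨|C|, abs_nonneg C, fun a b c d k D x y => ?_⟩
  set X : Matrix (Fin k) (Fin k) (Matrix m n A) :=
    Matrix.of fun p q => Matrix.single b d (D p q) with hX
  set T := CStarMatrix.ofMatrix (Matrix.comp (Fin k) (Fin k) m n (Y →L[ℂ] Y) (X.map φ)) with hT
  have hTn : ‖T‖ ≤ |C| * ‖D‖ :=
    (hC k X).trans ((mul_le_mul_of_nonneg_right (le_abs_self C) (norm_nonneg _)).trans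
      (mul_le_mul_of_nonneg_left (norm_comp_single_le D b d) (abs_nonneg C)))
  have h := norm_sum_inner_le T (fun p => if p.2 = a then x p.1 else 0)
    (fun q => if q.2 = c then y q.1 else 0)
  have hTa : ∀ p q, T p q = φ (Matrix.single b d (D p.1 q.1)) p.2 q.2 := fun p q => rfl
  have h1 : ∑ p, ∑ q, inner ℂ ((fun p : Fin k × m => if p.2 = a then x p.1 else 0) p)
      (T p q ((fun q : Fin k × n => if q.2 = c then y q.1 else 0) q)) =
      ∑ i, ∑ j, inner ℂ (x i) (φ (Matrix.single b d (D i j)) a c (y j)) := by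
    simp only [hTa, Fintype.sum_prod_type]
    refine Finset.sum_congr rfl fun i _ => ?_
    rw [Finset.sum_eq_single a (fun b' _ hb' => by simp [hb']) (by simp)]
    refine Finset.sum_congr rfl fun j _ => ?_
    rw [Finset.sum_eq_single c (fun b' _ hb' => by simp [hb']) (by simp)]
    simp
  have h2 : ∑ p, ‖(fun p : Fin k × m => if p.2 = a then x p.1 else 0) p‖ ^ 2 =
      ∑ i, ‖x i‖ ^ 2 := by
    simp only [Fintype.sum_prod_type]
    refine Finset.sum_congr rfl fun i _ => ?_
    rw [Finset.sum_eq_single a (fun b' _ hb' => by simp [hb']) (by simp)]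
    simp
  have h3 : ∑ p, ‖(fun p : Fin k × n => if p.2 = c then y p.1 else 0) p‖ ^ 2 =
      ∑ i, ‖y i‖ ^ 2 := by
    simp only [Fintype.sum_prod_type]
    refine Finset.sum_congr rfl fun i _ => ?_
    rw [Finset.sum_eq_single c (fun b' _ hb' => by simp [hb']) (by simp)]
    simp
  rw [h1, h2, h3] at h
  refine h.trans ?_
  rw [mul_assoc]
  have hx : 0 ≤ ∑ i, ‖x i‖ ^ 2 := Finset.sum_nonneg fun _ _ => by positivity
  have hy : 0 ≤ ∑ i, ‖y i‖ ^ 2 := Finset.sum_nonneg fun _ _ => by positivity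
  refine mul_le_mul hTn ?_ (by positivity) (by positivity)
  nlinarith [sq_nonneg (√(∑ i, ‖x i‖ ^ 2) - √(∑ i, ‖y i‖ ^ 2)), Real.sq_sqrt hx, Real.sq_sqrt hy,
    Real.sqrt_nonneg (∑ i, ‖x i‖ ^ 2), Real.sqrt_nonneg (∑ i, ‖y i‖ ^ 2)]

end MatrixNorm

/-! ### Matrices of maps -/

section MatrixMaps

variable {I A Y : Type*} [CStarAlgebra A]
  [NormedAddCommGroup Y] [InnerProductSpace ℂ Y]

/-- Complete positivity of the map `a ↦ [θ i j a]` in terms of sesquilinear forms. -/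
def IsMatrixPositive (θ : I → I → A →ₗ[ℂ] Y →L[ℂ] Y) : Prop :=
  ∀ (n : ℕ) (s : Fin n → I) (a : Fin n → A) (y : Fin n → Y),
    0 ≤ ∑ p, ∑ q, inner ℂ (y p) (θ (s p) (s q) (star (a p) * a q) (y q))

lemma IsMatrixPositive.sum_nonneg {θ : I → I → A →ₗ[ℂ] Y →L[ℂ] Y} (hθ : IsMatrixPositive θ)
    {κ : Type*} [Fintype κ] (s : κ → I) (a : κ → A) (y : κ → Y) :
    0 ≤ ∑ p, ∑ q, inner ℂ (y p) (θ (s p) (s q) (star (a p) * a q) (y q)) := by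
  have e := (Fintype.equivFin κ).symm
  have h := hθ _ (s ∘ e) (a ∘ e) (y ∘ e)
  simp only [Function.comp_apply] at h
  rw [e.sum_comp (fun p => ∑ j, inner ℂ (y p) (θ (s p) (s (e j)) (star (a p) * a (e j)) (y (e j))))]
    at h
  convert h using 2 with p
  exact (e.sum_comp fun q => inner ℂ (y p) (θ (s p) (s q) (star (a p) * a q) (y q))).symm

/-- The inclusion of a coordinate into the Hilbert sum of copies of `Y`. -/
noncomputable def coordInclusion (Y : Type*) [NormedAddCommGroup Y] [InnerProductSpace ℂ Y]
    [DecidableEq I] (i : I) : Y →L[ℂ] PiLp 2 fun _ : I => Y :=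
  (PiLp.continuousLinearEquiv 2 ℂ fun _ : I => Y).symm.toContinuousLinearMap ∘L
    ContinuousLinearMap.single ℂ (fun _ : I => Y) i

lemma coordInclusion_apply [DecidableEq I] (i j : I) (y : Y) :
    coordInclusion Y i y j = if i = j then y else 0 := by
  by_cases h : i = j
  · subst h; simp [coordInclusion]
  · simp [coordInclusion, h, Ne.symm h]

variable [Fintype I]

lemma inner_coordInclusion_right [DecidableEq I] (h : PiLp 2 fun _ : I => Y) (i : I) (y : Y) :
    inner ℂ h (coordInclusion Y i y) = inner ℂ (h i) y := by
  rw [PiLp.inner_apply, Finset.sum_eq_single i]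
  · simp [coordInclusion_apply]
  · intro j _ hj
    simp [coordInclusion_apply, Ne.symm hj]
  · simp

lemma inner_coordInclusion_left [DecidableEq I] (h : PiLp 2 fun _ : I => Y) (i : I) (y : Y) :
    inner ℂ (coordInclusion Y i y) h = inner ℂ y (h i) := by
  rw [← inner_conj_symm, inner_coordInclusion_right, inner_conj_symm]

/-- The map `a ↦ [θ i j a]` into the bounded operators on the Hilbert sum of copies of `Y`. -/
noncomputable def matrixOperatorMap [DecidableEq I] (θ : I → I → A →ₗ[ℂ] Y →L[ℂ] Y) :
    A →ₗ[ℂ] (PiLp 2 fun _ : I => Y) →L[ℂ] PiLp 2 fun _ : I => Y where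
  toFun a := ∑ i, ∑ j, coordInclusion Y i ∘L θ i j a ∘L PiLp.proj 2 (fun _ : I => Y) j
  map_add' a b := by
    simp [ContinuousLinearMap.add_comp, ContinuousLinearMap.comp_add, Finset.sum_add_distrib]
  map_smul' c a := by
    simp [ContinuousLinearMap.smul_comp, Finset.smul_sum]

lemma inner_matrixOperatorMap [DecidableEq I] (θ : I → I → A →ₗ[ℂ] Y →L[ℂ] Y) (a : A)
    (h h' : PiLp 2 fun _ : I => Y) :
    inner ℂ h (matrixOperatorMap θ a h') = ∑ i, ∑ j, inner ℂ (h i) (θ i j a (h' j)) := by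
  simp [matrixOperatorMap, sum_apply, inner_coordInclusion_right]

/-- Each coordinate satisfies ‖y i‖ ≤ ‖y‖; the 2 comes from the two sums of squares in the bound on
an entry. -/
lemma isFormBounded_matrixOperatorMap [DecidableEq I] [PartialOrder A] [StarOrderedRing A]
    {θ : I → I → A →ₗ[ℂ] Y →L[ℂ] Y}
    {C : I → I → ℝ} (hC : ∀ i j, 0 ≤ C i j)
    (hθ : ∀ i j (k : ℕ) (D : CStarMatrix (Fin k) (Fin k) A) (x y : Fin k → Y),
      ‖∑ p, ∑ q, inner ℂ (x p) (θ i j (D p q) (y q))‖ ≤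
        C i j * ‖D‖ * (∑ p, ‖x p‖ ^ 2 + ∑ p, ‖y p‖ ^ 2)) :
    IsFormBounded (matrixOperatorMap θ) (2 * ∑ i, ∑ j, C i j) := by
  intro k D y
  have h1 : ∑ p, ∑ q, inner ℂ (y p) (matrixOperatorMap θ (D p q) (y q)) =
      ∑ i, ∑ j, ∑ p, ∑ q, inner ℂ (y p i) (θ i j (D p q) (y q j)) := by
    simp only [inner_matrixOperatorMap]
    rw [Finset.sum_reverse_four]
    rw [Finset.sum_comm]
    refine Finset.sum_congr rfl fun i _ => Finset.sum_congr rfl fun j _ => Finset.sum_comm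
  have h2 : ∀ i, ∑ p, ‖y p i‖ ^ 2 ≤ ∑ p, ‖y p‖ ^ 2 := fun i => by
    refine Finset.sum_le_sum fun p _ => ?_
    exact pow_le_pow_left₀ (norm_nonneg _) (PiLp.norm_apply_le (y p) i) 2
  rw [h1]
  calc ‖∑ i, ∑ j, ∑ p, ∑ q, inner ℂ (y p i) (θ i j (D p q) (y q j))‖
      ≤ ∑ i, ∑ j, ‖∑ p, ∑ q, inner ℂ (y p i) (θ i j (D p q) (y q j))‖ :=
        (norm_sum_le _ _).trans (Finset.sum_le_sum fun i _ => norm_sum_le _ _)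
    _ ≤ ∑ i, ∑ j, C i j * (‖D‖ * (2 * ∑ p, ‖y p‖ ^ 2)) := by
        refine Finset.sum_le_sum fun i _ => Finset.sum_le_sum fun j _ => ?_
        refine (hθ i j k D (fun p => y p i) (fun p => y p j)).trans ?_
        rw [mul_assoc]
        refine mul_le_mul_of_nonneg_left ?_ (hC i j)
        refine mul_le_mul_of_nonneg_left ?_ (norm_nonneg D)
        linarith [h2 i, h2 j]
    _ = _ := by
        simp only [← Finset.sum_mul]
        ring

/-- **Wittstock decomposition** for matrices of completely bounded maps. -/
theorem exists_isMatrixPositive_sub [CompleteSpace Y] [PartialOrder A] [StarOrderedRing A]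
    {θ : I → I → A →ₗ[ℂ] Y →L[ℂ] Y} {C : I → I → ℝ} (hC : ∀ i j, 0 ≤ C i j)
    (hθ : ∀ i j (k : ℕ) (D : CStarMatrix (Fin k) (Fin k) A) (x y : Fin k → Y),
      ‖∑ p, ∑ q, inner ℂ (x p) (θ i j (D p q) (y q))‖ ≤
        C i j * ‖D‖ * (∑ p, ‖x p‖ ^ 2 + ∑ p, ‖y p‖ ^ 2))
    (hherm : ∀ i j a, θ i j (star a) = star (θ j i a)) :
    ∃ ψ₁ ψ₂ : I → I → A →ₗ[ℂ] Y →L[ℂ] Y, IsMatrixPositive ψ₁ ∧ IsMatrixPositive ψ₂ ∧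
      ∀ i j a, θ i j a = ψ₁ i j a - ψ₂ i j a := by
  classical
  obtain ⟨ψ, h1, h2⟩ := exists_isFormPositive_sub
    (mul_nonneg zero_le_two (Finset.sum_nonneg fun i _ => Finset.sum_nonneg fun j _ => hC i j))
    (isFormBounded_matrixOperatorMap hC hθ) (fun a => by
      ext1 h
      refine ext_inner_left ℂ fun h' => ?_
      rw [ContinuousLinearMap.star_eq_adjoint, ContinuousLinearMap.adjoint_inner_right,
        ← inner_conj_symm (matrixOperatorMap θ a h') h, inner_matrixOperatorMap, inner_matrixOperatorMap, Finset.sum_comm]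
      simp only [map_sum, inner_conj_symm]
      refine Finset.sum_congr rfl fun j _ => Finset.sum_congr rfl fun i _ => ?_
      rw [hherm, ContinuousLinearMap.star_eq_adjoint, ContinuousLinearMap.adjoint_inner_right])
  -- Compression to coordinates inverts `matrixOperatorMap` and turns form positivity into matrix
  -- positivity.
  let entry : (A →ₗ[ℂ] (PiLp 2 fun _ : I => Y) →L[ℂ] PiLp 2 fun _ : I => Y) →
      I → I → A →ₗ[ℂ] Y →L[ℂ] Y := fun χ i j =>
    { toFun := fun a => PiLp.proj 2 (fun _ : I => Y) i ∘L χ a ∘L coordInclusion Y j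
      map_add' := fun a b => by
        simp [ContinuousLinearMap.add_comp, ContinuousLinearMap.comp_add]
      map_smul' := fun c a => by
        simp [ContinuousLinearMap.smul_comp] }
  have hentry : ∀ χ i j a y, entry χ i j a y = χ a (coordInclusion Y j y) i :=
    fun χ i j a y => rfl
  have hpos : ∀ χ, IsFormPositive χ → IsMatrixPositive (entry χ) := fun χ hχ n s a y => by
    have := hχ n a fun p => coordInclusion Y (s p) (y p)
    simpa only [inner_coordInclusion_left, ← hentry] using this
  refine ⟨entry ψ, entry (ψ - matrixOperatorMap θ), hpos _ h1, hpos _ h2, fun i j a => ?_⟩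
  ext y
  rw [sub_apply, hentry, hentry, LinearMap.sub_apply, sub_apply, PiLp.sub_apply, sub_sub_cancel]
  refine ext_inner_left ℂ fun y' => ?_
  rw [← inner_coordInclusion_left, inner_matrixOperatorMap, Finset.sum_eq_single i,
    Finset.sum_eq_single j]
  · simp [coordInclusion_apply]
  · intro j' _ hj'
    simp [coordInclusion_apply, Ne.symm hj']
  · simp
  · intro i' _ hi'
    simp [coordInclusion_apply, Ne.symm hi']
  · simp

end MatrixMaps

/-! ### Completely positive maps from matrices of maps -/

section Sums

variable {ι₁ ι₂ ι₃ ι₄ ι₅ M : Type*} [AddCommMonoid M]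

lemma Finset.sum_comm_four (r : Finset ι₅) (s : Finset ι₁)
    (t : Finset ι₂) (u : Finset ι₃) (v : Finset ι₄) (f : ι₅ → ι₁ → ι₂ → ι₃ → ι₄ → M) :
    ∑ a ∈ r, ∑ i ∈ s, ∑ j ∈ t, ∑ k ∈ u, ∑ l ∈ v, f a i j k l =
      ∑ i ∈ s, ∑ j ∈ t, ∑ k ∈ u, ∑ l ∈ v, ∑ a ∈ r, f a i j k l := by
  rw [Finset.sum_comm]
  refine Finset.sum_congr rfl fun i _ => ?_
  rw [Finset.sum_comm]
  refine Finset.sum_congr rfl fun j _ => ?_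
  rw [Finset.sum_comm]
  exact Finset.sum_congr rfl fun k _ => Finset.sum_comm

lemma Fintype.sum_sum_prod [Fintype ι₁] [Fintype ι₂] (f : ι₁ × ι₂ → ι₁ × ι₂ → M) :
    ∑ p, ∑ q, f p q = ∑ a, ∑ b, ∑ c, ∑ d, f (a, c) (b, d) := by
  simp only [Fintype.sum_prod_type]
  exact Finset.sum_congr rfl fun p _ => Finset.sum_comm

end Sums

/-! ### Positivity of operator matrices and of conjugated sums. -/

section CompletelyPositive

lemma CStarAlgebra.exists_eq_star_mul_self {C : Type*} [NonUnitalCStarAlgebra C] [PartialOrder C]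
    [StarOrderedRing C] {x : C} (hx : 0 ≤ x) : ∃ y, x = star y * y :=
  CStarAlgebra.nonneg_iff_eq_star_mul_self.mp hx

lemma CStarMatrix.finset_sum_apply {κ m n B : Type*} [AddCommMonoid B] (s : Finset κ)
    (f : κ → CStarMatrix m n B) (i : m) (j : n) :
    (∑ r ∈ s, f r) i j = ∑ r ∈ s, f r i j := by
  classical
  induction s using Finset.induction_on with
  | empty => simp
  | insert a s ha ih => rw [Finset.sum_insert ha, Finset.sum_insert ha, CStarMatrix.add_apply, ih]

variable {I κ m n m' n' l l' A B Y : Type*}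

lemma CStarMatrix.star_mul_apply_apply [Fintype κ] [Fintype m] [CStarAlgebra B]
    (N : CStarMatrix κ κ (CStarMatrix m m B)) (p q : κ) (a b : m) :
    (star N * N) p q a b = ∑ r, ∑ c, star (N r p c a) * N r q c b := by
  rw [CStarMatrix.mul_apply, CStarMatrix.finset_sum_apply]
  refine Finset.sum_congr rfl fun r _ => ?_
  rw [CStarMatrix.star_apply, CStarMatrix.mul_apply]
  simp only [CStarMatrix.star_apply]

/-- T is read as one operator R on the Hilbert sum of copies of Y, which is positive by hypothesis.
Factor R = S*S; the operator entries of S form a matrix N with T = N*N. -/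
lemma CStarMatrix.nonneg_of_form_nonneg [Fintype κ] [Fintype m]
    [NormedAddCommGroup Y] [InnerProductSpace ℂ Y] [CompleteSpace Y]
    {T : CStarMatrix κ κ (CStarMatrix m m (Y →L[ℂ] Y))}
    (hT : ∀ y : κ → m → Y, 0 ≤ ∑ p, ∑ q, ∑ a, ∑ b, inner ℂ (y p a) (T p q a b (y q b))) :
    0 ≤ T := by
  classical
  let θ : κ × m → κ × m → ℂ →ₗ[ℂ] Y →L[ℂ] Y := fun p q =>
    LinearMap.toSpanSingleton ℂ _ (T p.1 q.1 p.2 q.2)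
  set R := matrixOperatorMap θ 1 with hR
  have hRinner : ∀ h h', inner ℂ h (R h') =
      ∑ p : κ × m, ∑ q : κ × m, inner ℂ (h p) (T p.1 q.1 p.2 q.2 (h' q)) := fun h h' => by
    rw [hR, inner_matrixOperatorMap]
    simp [θ]
  have hR0 : 0 ≤ R := by
    rw [ContinuousLinearMap.nonneg_iff_isPositive, ContinuousLinearMap.isPositive_iff_complex]
    intro h
    have h1 : 0 ≤ inner ℂ h (R h) := by
      rw [hRinner]
      rw [Fintype.sum_sum_prod]
      exact hT fun p a => h (p, a)
    have h2 : inner ℂ (R h) h = inner ℂ h (R h) := by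
      rw [← inner_conj_symm]
      exact Complex.conj_eq_iff_im.mpr (Complex.nonneg_iff.mp h1).2.symm
    rw [h2]
    exact ⟨Complex.ext rfl (Complex.nonneg_iff.mp h1).2, (Complex.nonneg_iff.mp h1).1⟩
  obtain ⟨S, hS⟩ := CStarAlgebra.exists_eq_star_mul_self hR0
  let N : CStarMatrix κ κ (CStarMatrix m m (Y →L[ℂ] Y)) := CStarMatrix.ofMatrix fun r p =>
    CStarMatrix.ofMatrix fun c a =>
      PiLp.proj 2 (fun _ : κ × m => Y) (r, c) ∘L S ∘L coordInclusion Y (p, a)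
  have hN : ∀ r p c a y, N r p c a y = S (coordInclusion Y (p, a) y) (r, c) :=
    fun r p c a y => rfl
  have hTN : T = star N * N := by
    ext p q : 1
    ext a b : 1
    ext1 y
    refine ext_inner_left ℂ fun y' => ?_
    rw [CStarMatrix.star_mul_apply_apply]
    simp only [sum_apply, inner_sum, mul_apply_eq_comp,
      ContinuousLinearMap.star_eq_adjoint, ContinuousLinearMap.adjoint_inner_right, hN]
    rw [← Fintype.sum_prod_type'
      (f := fun r c => inner ℂ (S (coordInclusion Y (p, a) y') (r, c))
        (S (coordInclusion Y (q, b) y) (r, c)))]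
    change _ = ∑ x : κ × m, inner ℂ (S (coordInclusion Y (p, a) y') x)
        (S (coordInclusion Y (q, b) y) x)
    rw [← PiLp.inner_apply, ← ContinuousLinearMap.adjoint_inner_right,
      ← ContinuousLinearMap.star_eq_adjoint, ← mul_apply_eq_comp, ← hS, hRinner,
      Finset.sum_eq_single (p, a), Finset.sum_eq_single (q, b)]
    · simp [coordInclusion_apply]
    · intro j _ hj
      simp [coordInclusion_apply, Ne.symm hj]
    · simp
    · intro j _ hj
      simp [coordInclusion_apply, Ne.symm hj]
    · simp
  rw [hTN]
  exact star_mul_self_nonneg N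

/-- The map `P ↦ ∑ X i * [ψ i j (P c d)] * (X' j)*`. -/
noncomputable def conjSum [Fintype I] [Fintype m] [Fintype n] [AddCommGroup A] [Module ℂ A]
    [AddCommGroup B] [Module ℂ B] (X : I → Matrix m' m ℂ) (X' : I → Matrix n' n ℂ)
    (ψ : I → I → A →ₗ[ℂ] B) : Matrix m n A →ₗ[ℂ] Matrix m' n' B where
  toFun P := Matrix.of fun a b =>
    ∑ i, ∑ j, ∑ c, ∑ d, (X i a c * star (X' j b d)) • ψ i j (P c d)
  map_add' P Q := by
    ext a b
    simp [Finset.sum_add_distrib]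
  map_smul' c P := by
    ext a b
    simp [Finset.smul_sum, smul_comm c]

lemma conjSum_apply [Fintype I] [Fintype m] [Fintype n] [AddCommGroup A] [Module ℂ A]
    [AddCommGroup B] [Module ℂ B] (X : I → Matrix m' m ℂ) (X' : I → Matrix n' n ℂ)
    (ψ : I → I → A →ₗ[ℂ] B) (P : Matrix m n A) (a : m') (b : n') :
    conjSum X X' ψ P a b = ∑ i, ∑ j, ∑ c, ∑ d, (X i a c * star (X' j b d)) • ψ i j (P c d) :=
  rfl

section Bimodule

variable [Fintype I] [Fintype m] [Fintype n] [AddCommGroup A] [Module ℂ A]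
  [AddCommGroup B] [Module ℂ B] (X : I → Matrix m' m ℂ) (X' : I → Matrix n' n ℂ)
  (ψ : I → I → A →ₗ[ℂ] B)

lemma lmul_conjSum [Fintype m'] (α : Matrix l m' ℂ) (P : Matrix m n A) :
    lmul α (conjSum X X' ψ P) = conjSum (fun i => α * X i) X' ψ P := by
  ext a b
  simp only [lmul, Matrix.of_apply, conjSum_apply, Matrix.mul_apply, Finset.sum_mul,
    Finset.sum_smul, Finset.smul_sum, smul_smul]
  rw [Finset.sum_comm_four]
  simp only [mul_assoc]

lemma rmul_conjSum [Fintype n'] (β : Matrix l' n' ℂ) (P : Matrix m n A) :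
    rmul (conjSum X X' ψ P) β.conjTranspose = conjSum X (fun i => β * X' i) ψ P := by
  ext a b
  simp only [rmul, Matrix.of_apply, conjSum_apply, Matrix.mul_apply, Finset.mul_sum, star_sum,
    Finset.sum_smul, Finset.smul_sum, smul_smul, Matrix.conjTranspose_apply]
  rw [Finset.sum_comm_four]
  simp only [star_mul', mul_left_comm]

lemma conjSum_lmul [Fintype l] (α : Matrix m l ℂ) (P : Matrix l n A) :
    conjSum X X' ψ (lmul α P) = conjSum (fun i => X i * α) X' ψ P := by
  ext a b
  simp only [lmul, Matrix.of_apply, conjSum_apply, Matrix.mul_apply, Finset.sum_mul, map_sum,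
    map_smul, Finset.sum_smul, Finset.smul_sum, smul_smul]
  refine Finset.sum_congr rfl fun i _ => Finset.sum_congr rfl fun j _ => ?_
  rw [Finset.sum_comm]
  conv_rhs => rw [Finset.sum_comm]
  refine Finset.sum_congr rfl fun d _ => ?_
  rw [Finset.sum_comm]
  simp only [mul_right_comm]

lemma conjSum_rmul [Fintype l'] (β : Matrix n l' ℂ) (P : Matrix m l' A) :
    conjSum X X' ψ (rmul P β.conjTranspose) = conjSum X (fun i => X' i * β) ψ P := by
  ext a b
  simp only [rmul, Matrix.of_apply, conjSum_apply, Matrix.mul_apply, Finset.mul_sum, star_sum,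
    map_sum, map_smul, Finset.sum_smul, Finset.smul_sum, smul_smul, Matrix.conjTranspose_apply]
  refine Finset.sum_congr rfl fun i _ => Finset.sum_congr rfl fun j _ =>
    Finset.sum_congr rfl fun c _ => ?_
  rw [Finset.sum_comm]
  simp only [star_mul', mul_assoc]

end Bimodule

variable [Fintype I] [Fintype m] [Fintype n] [Fintype m'] [Fintype n'] [CStarAlgebra A]
  [NormedAddCommGroup Y] [InnerProductSpace ℂ Y]

lemma sum_inner_conjSum (X : I → Matrix m' m ℂ) (X' : I → Matrix n' n ℂ)
    (ψ : I → I → A →ₗ[ℂ] Y →L[ℂ] Y) (P : Matrix m n A) (x : m' → Y) (y : n' → Y) :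
    ∑ a, ∑ b, inner ℂ (x a) (conjSum X X' ψ P a b (y b)) =
      ∑ u : I × m, ∑ v : I × n, inner ℂ (∑ a, star (X u.1 a u.2) • x a)
        (ψ u.1 v.1 (P u.2 v.2) (∑ b, star (X' v.1 b v.2) • y b)) := by
  simp only [conjSum_apply, sum_apply, smul_apply, inner_sum, inner_smul_right, sum_inner,
    map_sum, map_smul, inner_smul_left, Fintype.sum_prod_type]
  refine ((Finset.sum_congr rfl fun a _ => Finset.sum_comm_four _ _ _ _ _ _).trans
    (Finset.sum_comm_four _ _ _ _ _ _)).trans ?_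
  refine Finset.sum_congr rfl fun i _ => ?_
  rw [Finset.sum_comm]
  refine Finset.sum_congr rfl fun c _ => Finset.sum_congr rfl fun j _ =>
    Finset.sum_congr rfl fun d _ => ?_
  rw [Finset.sum_comm]
  simp only [Finset.mul_sum]
  refine Finset.sum_congr rfl fun b _ => Finset.sum_congr rfl fun a _ => ?_
  rw [starRingEnd_apply, star_star]
  ring

variable [PartialOrder A] [StarOrderedRing A] [CompleteSpace Y]

/-- For a positive matrix N*N, moving each X i onto the vectors writes the form as a sum, over the
rows (r, e) of N, of forms of ψ at the entries of that row, with index set the triples (p, i, c).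
Each of these is nonnegative. -/
theorem isCompletelyPositive_conjSum (X : I → Matrix m' m ℂ) {ψ : I → I → A →ₗ[ℂ] Y →L[ℂ] Y}
    (hψ : IsMatrixPositive ψ) : IsCompletelyPositive (conjSum X X ψ) := by
  let f : CStarMatrix m m A →ₗ[ℂ] CStarMatrix m' m' (Y →L[ℂ] Y) :=
    CStarMatrix.ofMatrixₗ.toLinearMap ∘ₗ conjSum X X ψ ∘ₗ
      (CStarMatrix.ofMatrixₗ (R := ℂ)).symm.toLinearMap
  have hf : ∀ (P : CStarMatrix m m A) a b, f P a b = conjSum X X ψ P a b := fun P a b => rfl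
  refine ⟨⟨f, fun k M hM => ?_⟩, fun P => rfl⟩
  obtain ⟨N, rfl⟩ := CStarAlgebra.exists_eq_star_mul_self hM
  refine CStarMatrix.nonneg_of_form_nonneg fun y => ?_
  let z : Fin k × I × m → Y := fun p => ∑ a, star (X p.2.1 a p.2.2) • y p.1 a
  have h1 : ∑ p, ∑ q, ∑ a, ∑ b, inner ℂ (y p a) (((star N * N).map f) p q a b (y q b)) =
      ∑ r, ∑ e, ∑ p : Fin k × I × m, ∑ q : Fin k × I × m,
        inner ℂ (z p) (ψ p.2.1 q.2.1 (star (N r p.1 e p.2.2) * N r q.1 e q.2.2) (z q)) := by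
    have hform : ∀ p q, ∑ a, ∑ b, inner ℂ (y p a) (((star N * N).map f) p q a b (y q b)) =
        ∑ u : I × m, ∑ v : I × m, ∑ r, ∑ e, inner ℂ (z (p, u))
          (ψ u.1 v.1 (star (N r p e u.2) * N r q e v.2) (z (q, v))) := fun p q => by
      refine (sum_inner_conjSum X X ψ (CStarMatrix.ofMatrix.symm ((star N * N) p q))
        (y p) (y q)).trans ?_
      refine Finset.sum_congr rfl fun u _ => Finset.sum_congr rfl fun v _ => ?_
      rw [CStarMatrix.ofMatrix_symm_apply, CStarMatrix.star_mul_apply_apply]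
      change inner ℂ (z (p, u)) (ψ u.1 v.1 _ (z (q, v))) = _
      generalize z (q, v) = w
      simp only [map_sum, sum_apply, inner_sum]
    calc _ = ∑ p, ∑ q, ∑ u : I × m, ∑ v : I × m, ∑ r, ∑ e, inner ℂ (z (p, u))
          (ψ u.1 v.1 (star (N r p e u.2) * N r q e v.2) (z (q, v))) :=
          Finset.sum_congr rfl fun p _ => Finset.sum_congr rfl fun q _ => hform p q
      _ = ∑ r, ∑ e, ∑ p, ∑ q, ∑ u : I × m, ∑ v : I × m, inner ℂ (z (p, u))
          (ψ u.1 v.1 (star (N r p e u.2) * N r q e v.2) (z (q, v))) :=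
          ((Finset.sum_congr rfl fun r _ => Finset.sum_comm_four _ _ _ _ _ _).trans
            (Finset.sum_comm_four _ _ _ _ _ _)).symm
      _ = _ := Finset.sum_congr rfl fun r _ => Finset.sum_congr rfl fun e _ =>
          (Fintype.sum_sum_prod fun p q : Fin k × I × m => inner ℂ (z p)
            (ψ p.2.1 q.2.1 (star (N r p.1 e p.2.2) * N r q.1 e q.2.2) (z q))).symm
  rw [h1]
  exact Finset.sum_nonneg fun r _ => Finset.sum_nonneg fun e _ =>
    hψ.sum_nonneg (fun p : Fin k × I × m => p.2.1) (fun p => N r p.1 e p.2.2) z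

lemma IsCompletelyPositive.add {φ₁ φ₂ : Matrix m m A →ₗ[ℂ] Matrix m' m' (Y →L[ℂ] Y)}
    (h₁ : IsCompletelyPositive φ₁) (h₂ : IsCompletelyPositive φ₂) :
    IsCompletelyPositive (φ₁ + φ₂) := by
  obtain ⟨f₁, hf₁⟩ := h₁
  obtain ⟨f₂, hf₂⟩ := h₂
  refine ⟨⟨f₁.toLinearMap + f₂.toLinearMap, fun k M hM => ?_⟩, fun P => ?_⟩
  · have : M.map (f₁.toLinearMap + f₂.toLinearMap) =
        M.map f₁.toLinearMap + M.map f₂.toLinearMap := by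
      ext; rfl
    rw [this]
    exact add_nonneg (f₁.map_cstarMatrix_nonneg' k M hM) (f₂.map_cstarMatrix_nonneg' k M hM)
  · exact congrArg₂ (· + ·) (hf₁ P) (hf₂ P)

end CompletelyPositive

/-! ### Decomposition of kernels -/

section Commutant

variable {Ω : Type*} {n : Ω → Type*} [∀ Z, Fintype (n Z)]

/-- The families of square matrices that intertwine all matrices of `R`. -/
def intertwiningFamilies (R : ∀ Z Z', Set (Matrix (n Z') (n Z) ℂ)) :
    Submodule ℂ (∀ Z, Matrix (n Z) (n Z) ℂ) where
  carrier := {X | ∀ Z Z', ∀ α ∈ R Z Z', α * X Z = X Z' * α}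
  add_mem' := fun hX hX' Z Z' α hα => by
    rw [Pi.add_apply, Pi.add_apply, Matrix.mul_add, Matrix.add_mul, hX Z Z' α hα, hX' Z Z' α hα]
  zero_mem' := fun Z Z' α _ => by simp
  smul_mem' := fun c X hX Z Z' α hα => by
    rw [Pi.smul_apply, Pi.smul_apply, Matrix.mul_smul, Matrix.smul_mul, hX Z Z' α hα]

/-- A subspace of families of square matrices has elements that express each of its elements
through the entries of that element. -/
lemma Submodule.exists_eq_sum_entry_smul [Fintype Ω]
    (T : Submodule ℂ (∀ Z, Matrix (n Z) (n Z) ℂ)) :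
    ∃ X : (Σ Z, n Z × n Z) → ∀ Z, Matrix (n Z) (n Z) ℂ, (∀ i, X i ∈ T) ∧
      ∀ Q ∈ T, Q = ∑ i : Σ Z, n Z × n Z, Q i.1 i.2.1 i.2.2 • X i := by
  classical
  -- Any linear projection onto T will do: expand Q in matrix units and apply π, which fixes Q.
  obtain ⟨π, hπ⟩ := LinearMap.exists_leftInverse_of_injective T.subtype T.ker_subtype
  refine ⟨fun i => π (Pi.single i.1 (Matrix.single i.2.1 i.2.2 1)), fun i => Subtype.property _,
    fun Q hQ => ?_⟩
  have h1 : Q = π Q := congrArg Subtype.val (LinearMap.congr_fun hπ ⟨Q, hQ⟩).symm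
  have h2 : Q = ∑ i : Σ Z, n Z × n Z,
      Q i.1 i.2.1 i.2.2 • (Pi.single i.1 (Matrix.single i.2.1 i.2.2 1) :
        ∀ Z, Matrix (n Z) (n Z) ℂ) := by
    simp only [← Pi.single_smul, Matrix.smul_single, smul_eq_mul, mul_one, Fintype.sum_sigma,
      Fintype.sum_prod_type]
    conv_lhs => rw [← Finset.univ_sum_single Q]
    refine Finset.sum_congr rfl fun Z _ => ?_
    conv_lhs => rw [Matrix.matrix_eq_sum_single (Q Z)]
    rw [← AddMonoidHom.single_apply, map_sum]
    simp only [map_sum, AddMonoidHom.single_apply]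
  conv_lhs => rw [h1, h2]
  simp

variable {Y : Type*} [NormedAddCommGroup Y] [InnerProductSpace ℂ Y]

/-- The expansion carries over to operator entries by testing on the scalar matrices ⟪y', Q y⟫,
which intertwine too. -/
lemma eq_sum_smul_of_intertwining {I : Type*} [Fintype I] {R : ∀ Z Z', Set (Matrix (n Z') (n Z) ℂ)}
    {r : I → Σ Z, n Z × n Z} {X : I → ∀ Z, Matrix (n Z) (n Z) ℂ}
    (hX : ∀ Q ∈ intertwiningFamilies R, Q = ∑ i, Q (r i).1 (r i).2.1 (r i).2.2 • X i)
    (Q : ∀ Z, Matrix (n Z) (n Z) (Y →L[ℂ] Y))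
    (hQ : ∀ Z Z', ∀ α ∈ R Z Z', lmul α (Q Z) = rmul (Q Z') α) (Z : Ω) (a b : n Z) :
    Q Z a b = ∑ i, X i Z a b • Q (r i).1 (r i).2.1 (r i).2.2 := by
  ext y
  refine ext_inner_left ℂ fun y' => ?_
  have h := hX (fun Z => Matrix.of fun a b => inner ℂ y' (Q Z a b y)) fun Z Z' α hα => by
    ext a b
    have := congrArg (fun M : Matrix (n Z') (n Z) (Y →L[ℂ] Y) => inner ℂ y' (M a b y))
      (hQ Z Z' α hα)
    simp only [lmul, rmul, Matrix.of_apply, sum_apply, smul_apply, inner_sum,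
      inner_smul_right] at this
    simp only [Matrix.mul_apply, Matrix.of_apply, this, mul_comm]
  have h' := congrFun (congrFun (congrFun h Z) a) b
  simp only [Finset.sum_apply, Matrix.of_apply, Pi.smul_apply, Matrix.sum_apply, Matrix.smul_apply,
    smul_eq_mul] at h'
  simp only [h', sum_apply, smul_apply, inner_sum, inner_smul_right, mul_comm]

end Commutant

/-! ### Factoring a kernel through intertwining families. -/

section Kernel

variable {Ω : Type*} {n : Ω → Type*} [∀ Z, Fintype (n Z)] [∀ Z, DecidableEq (n Z)]
  {A Y : Type*} [CStarAlgebra A] [NormedAddCommGroup Y] [InnerProductSpace ℂ Y]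

lemma apply_eq_sum_apply_single {m n B : Type*} [Fintype m] [Fintype n] [DecidableEq m]
    [DecidableEq n] [AddCommGroup B] [Module ℂ B]
    (φ : Matrix m n A →ₗ[ℂ] Matrix m n B) (P : Matrix m n A) (a : m) (c : n) :
    φ P a c = ∑ b, ∑ d, φ (Matrix.single b d (P b d)) a c := by
  conv_lhs => rw [Matrix.matrix_eq_sum_single P]
  simp only [map_sum, Matrix.sum_apply]

variable [PartialOrder A] [StarOrderedRing A]

/-- A completely bounded Hermitian kernel that respects the matrices of `R` is the difference of two
completely positive kernels, written with matrices that intertwine those of `R`. -/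
theorem exists_conjSum_sub_conjSum [CompleteSpace Y] [Fintype Ω]
    {R : ∀ Z Z', Set (Matrix (n Z') (n Z) ℂ)}
    {K : ∀ Z W, Matrix (n Z) (n W) A →ₗ[ℂ] Matrix (n Z) (n W) (Y →L[ℂ] Y)}
    (hb : ∀ Z W, IsEntrywiseBounded (K Z W))
    (hR : ∀ Z Z' W, ∀ α ∈ R Z Z', ∀ P, lmul α (K Z W P) = K Z' W (lmul α P))
    (hherm : ∀ Z W P, K W Z P.conjTranspose = (K Z W P).conjTranspose) :
    ∃ (X : (Σ Z, n Z × n Z) → ∀ Z, Matrix (n Z) (n Z) ℂ)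
      (ψ₁ ψ₂ : (Σ Z, n Z × n Z) → (Σ Z, n Z × n Z) → A →ₗ[ℂ] Y →L[ℂ] Y),
      (∀ i Z Z', ∀ α ∈ R Z Z', α * X i Z = X i Z' * α) ∧
      IsMatrixPositive ψ₁ ∧ IsMatrixPositive ψ₂ ∧
      ∀ Z W P, K Z W P = conjSum (fun i => X i Z) (fun i => X i W) ψ₁ P -
        conjSum (fun i => X i Z) (fun i => X i W) ψ₂ P := by
  obtain ⟨X, hXR, hX⟩ := (intertwiningFamilies R).exists_eq_sum_entry_smul
  let θ : (Σ Z, n Z × n Z) → (Σ Z, n Z × n Z) → A →ₗ[ℂ] Y →L[ℂ] Y := fun i j =>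
    Matrix.entryLinearMap ℂ (Y →L[ℂ] Y) i.2.1 j.2.1 ∘ₗ K i.1 j.1 ∘ₗ
      Matrix.singleLinearMap ℂ i.2.2 j.2.2
  have hθ : ∀ i j p, θ i j p = K i.1 j.1 (Matrix.single i.2.2 j.2.2 p) i.2.1 j.2.1 :=
    fun i j p => rfl
  have hstar : ∀ Z W (b : n Z) (d : n W) p a c,
      K W Z (Matrix.single d b (star p)) c a = star (K Z W (Matrix.single b d p) a c) :=
    fun Z W b d p a c => by
      rw [← Matrix.conjTranspose_single, hherm, Matrix.conjTranspose_apply]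
  -- With W, c, d, p fixed, compatibility with α on p E_{bd} says exactly that the matrices indexed
  -- by (a, b) intertwine, so they expand in the X i.
  have hleft : ∀ Z W (a b : n Z) (c d : n W) p, K Z W (Matrix.single b d p) a c =
      ∑ i : Σ Z, n Z × n Z, X i Z a b • K i.1 W (Matrix.single i.2.2 d p) i.2.1 c :=
    fun Z W a b c d p => by
      refine eq_sum_smul_of_intertwining (r := id) hX
        (fun Z => Matrix.of fun a b => K Z W (Matrix.single b d p) a c)
        (fun Z Z' α hα => ?_) Z a b
      ext1 a b
      have h1 := congrFun (congrFun (hR Z Z' W α hα (Matrix.single b d p)) a) c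
      have h2 : lmul α (Matrix.single b d p) =
          ∑ e, α e b • (Matrix.single e d p : Matrix (n Z') (n W) A) := by
        ext a' c'
        rw [Matrix.sum_apply, Finset.sum_eq_single a']
        · simp only [lmul, Matrix.of_apply, Matrix.smul_apply]
          rw [Finset.sum_eq_single b]
          · simp [Matrix.single_apply]
          · intro b' _ hb'
            simp [Ne.symm hb']
          · simp
        · intro e _ he
          simp [he]
        · simp
      rw [h2, map_sum, Matrix.sum_apply] at h1
      simp only [map_smul, Matrix.smul_apply] at h1
      exact h1
  -- The right-hand expansion is the adjoint of the left one, by Hermitian symmetry.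
  have hright : ∀ Z W (a b : n Z) (c d : n W) p, K Z W (Matrix.single b d p) a c =
      ∑ j : Σ Z, n Z × n Z, star (X j W c d) • K Z j.1 (Matrix.single b j.2.2 p) a j.2.1 :=
    fun Z W a b c d p => by
      rw [← star_star p, hstar, hleft, star_sum]
      simp only [star_smul, ← hstar]
  choose C hC0 hC using fun p : Ω × Ω => hb p.1 p.2
  obtain ⟨ψ₁, ψ₂, h₁, h₂, hψ⟩ := exists_isMatrixPositive_sub (θ := θ)
    (C := fun i j => C (i.1, j.1)) (fun i j => hC0 _)
    (fun i j k D x y => hC (i.1, j.1) _ _ _ _ k D x y) (fun i j a => hstar _ _ _ _ _ _ _)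
  refine ⟨X, ψ₁, ψ₂, fun i => hXR i, h₁, h₂, fun Z W P => ?_⟩
  ext1 a c
  rw [apply_eq_sum_apply_single, Matrix.sub_apply, conjSum_apply, conjSum_apply]
  simp only [← Finset.sum_sub_distrib, ← smul_sub, ← hψ, hθ]
  have h := fun b d => (hleft Z W a b c d (P b d)).trans
    (Finset.sum_congr rfl fun i _ => congrArg _ (hright i.1 W i.2.1 i.2.2 c d (P b d)))
  simp only [h, Finset.smul_sum, smul_smul]
  rw [Finset.sum_comm]
  conv_lhs => enter [2, d]; rw [Finset.sum_comm]
  rw [Finset.sum_comm]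
  refine Finset.sum_congr rfl fun i _ => ?_
  conv_lhs => enter [2, d]; rw [Finset.sum_comm]
  rw [Finset.sum_comm]
  exact Finset.sum_congr rfl fun j _ => Finset.sum_comm

end Kernel

/-! ### The complete spectral-factorization property of C*-algebras -/

section SpectralFactorization

/-- Interpolate √ at the finitely many points of the spectrum. A polynomial, unlike a general root,
stays inside any algebra containing P; real coefficients keep it Hermitian. -/
lemma Matrix.PosSemidef.exists_polynomial_mul_self {m : Type*} [Fintype m] [DecidableEq m]
    {P : Matrix m m ℂ} (hP : P.PosSemidef) :
    ∃ p : Polynomial ℝ, (Polynomial.aeval P p).IsHermitian ∧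
      Polynomial.aeval P p * Polynomial.aeval P p = P := by
  open scoped MatrixOrder in
  have hsa : IsSelfAdjoint P := hP.isHermitian
  have hnn : ∀ x ∈ spectrum ℝ P, 0 ≤ x := fun x hx => by
    obtain ⟨i, rfl⟩ := Set.ext_iff.mp hP.isHermitian.spectrum_real_eq_range_eigenvalues x |>.mp hx
    exact hP.eigenvalues_nonneg i
  set s := P.finite_real_spectrum.toFinset with hs
  set p := Lagrange.interpolate s id Real.sqrt with hp
  have hpx : ∀ x ∈ spectrum ℝ P, p.eval x = √x := fun x hx =>
    Lagrange.eval_interpolate_at_node (s := s) (v := id) Real.sqrt Function.injective_id.injOn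
      (by simpa [hs] using hx)
  have hcfc : cfc p.eval P = Polynomial.aeval P p := cfc_polynomial p P
  refine ⟨p, ?_, ?_⟩
  · rw [← hcfc]
    exact cfc_predicate p.eval P
  · rw [← hcfc, ← cfc_mul p.eval p.eval P (by fun_prop) (by fun_prop)]
    conv_rhs => rw [← cfc_id' ℝ P]
    exact cfc_congr fun x hx => by simp only [hpx x hx, Real.mul_self_sqrt (hnn x hx)]

/-- S equals the C*-algebra it generates, and the matrices over S form an algebra, so the polynomial
square root β of α has entries in S; being self-adjoint, β satisfies ββ* = β² = α. -/
theorem IsAdjointClosed.hasCompleteSpectralFactorization {m : Type*} [Fintype m] [DecidableEq m]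
    {S : Subalgebra ℂ (Matrix m m ℂ)} (hS : IsAdjointClosed S) :
    HasCompleteSpectralFactorization S := by
  intro n α hα hpos
  have hαS : ∀ i j, α i j ∈ S := fun i j => by
    let S' : StarSubalgebra ℂ (Matrix m m ℂ) := { S with star_mem' := fun {a} ha => hS a ha }
    have hle : StarAlgebra.adjoin ℂ (S : Set (Matrix m m ℂ)) ≤ S' :=
      StarAlgebra.adjoin_le (fun a ha => ha)
    exact hle (hα i j)
  obtain ⟨p, hp, hpp⟩ := hpos.posSemidef.exists_polynomial_mul_self
  let e : Matrix (Fin n) (Fin n) (Matrix m m ℂ) ≃ₐ[ℝ] Matrix (Fin n × m) (Fin n × m) ℂ :=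
    Matrix.compAlgEquiv (Fin n) m ℂ ℝ
  have he : ∀ M, e M = Matrix.comp (Fin n) (Fin n) m m ℂ M := fun M => rfl
  set β := Polynomial.aeval α p with hβ
  have heβ : e β = Polynomial.aeval (e α) p := (Polynomial.aeval_algHom_apply e α p).symm
  have hββ : α = β * β := e.injective (by rw [map_mul, heβ, he, hpp])
  have hβsa : β.conjTranspose = β := by
    refine e.injective ?_
    have h1 : e β.conjTranspose = (e β).conjTranspose := by ext; rfl
    rw [h1, heβ]
    exact hp
  refine ⟨β, fun i j => ?_, by rw [hβsa]; exact hββ⟩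
  have hmem : β ∈ (S.restrictScalars ℝ).matrix (n := Fin n) := by
    refine Algebra.adjoin_le (S := (S.restrictScalars ℝ).matrix (n := Fin n)) ?_
      (Polynomial.aeval_mem_adjoin_singleton ℝ α)
    rintro _ rfl
    exact fun i j => hαS i j
  exact hmem i j

end SpectralFactorization

/-! ### Bimodule maps -/

section BimoduleMaps

variable {A Y m : Type*} [CStarAlgebra A] [NormedAddCommGroup Y] [InnerProductSpace ℂ Y]
  [Fintype m] [DecidableEq m]

@[simp]
lemma rmul_one {l n E : Type*} [Fintype n] [DecidableEq n] [AddCommMonoid E] [Module ℂ E]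
    (P : Matrix l n E) : rmul P 1 = P := by
  ext i j
  simp [rmul, Matrix.one_apply, ite_smul]

lemma isBimoduleMap_conjSum {I : Type*} [Fintype I] {S : Subalgebra ℂ (Matrix m m ℂ)}
    {X : I → Matrix m m ℂ} (hX : ∀ i, ∀ α ∈ S, α * X i = X i * α)
    (ψ : I → I → A →ₗ[ℂ] Y →L[ℂ] Y) [CompleteSpace Y] : IsBimoduleMap S (conjSum X X ψ) := by
  intro α hα β hβ P
  rw [conjSum_rmul, conjSum_lmul, lmul_conjSum, rmul_conjSum]
  simp only [hX _ α hα, hX _ β hβ]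

variable [PartialOrder A] [StarOrderedRing A] [CompleteSpace Y]

/-- A completely bounded Hermitian bimodule map is the difference of two completely positive
bimodule maps. -/
theorem exists_bimodule_decomposition {S : Subalgebra ℂ (Matrix m m ℂ)}
    {φ : Matrix m m A →ₗ[ℂ] Matrix m m (Y →L[ℂ] Y)} (hb : IsCompletelyBounded φ)
    (hherm : IsHermitianMap φ) (hS : IsBimoduleMap S φ) :
    ∃ φ₁ φ₂ : Matrix m m A →ₗ[ℂ] Matrix m m (Y →L[ℂ] Y),
      IsCompletelyPositive φ₁ ∧ IsBimoduleMap S φ₁ ∧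
      IsCompletelyPositive φ₂ ∧ IsBimoduleMap S φ₂ ∧ φ = φ₁ - φ₂ ∧
      IsCompletelyPositive (offDiagonalMap (φ₁ + φ₂) φ (φ₁ + φ₂)) := by
  obtain ⟨X, ψ₁, ψ₂, hX, h₁, h₂, hφ⟩ := exists_conjSum_sub_conjSum
    (Ω := Unit) (n := fun _ => m) (R := fun _ _ => (S : Set (Matrix m m ℂ))) (K := fun _ _ => φ)
    (fun _ _ => hb.isEntrywiseBounded)
    (fun _ _ _ α hα P => by
      -- Only left multiplication is needed; the right side comes from Hermitian symmetry.
      have := hS α hα 1 S.one_mem P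
      rw [Matrix.conjTranspose_one, rmul_one, rmul_one] at this
      exact this.symm)
    (fun _ _ P => hherm P)
  set X₀ : _ → Matrix m m ℂ := fun i => X i () with hX₀
  have hXS : ∀ i, ∀ α ∈ S, α * X₀ i = X₀ i * α := fun i => hX i () ()
  have hφ' : φ = conjSum X₀ X₀ ψ₁ - conjSum X₀ X₀ ψ₂ := LinearMap.ext fun P => hφ () () P
  refine ⟨conjSum X₀ X₀ ψ₁, conjSum X₀ X₀ ψ₂, isCompletelyPositive_conjSum X₀ h₁,
    isBimoduleMap_conjSum hXS ψ₁, isCompletelyPositive_conjSum X₀ h₂,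
    isBimoduleMap_conjSum hXS ψ₂, hφ', ?_⟩
  -- The block map is [1; 1] φ₁ [1, 1] + [1; -1] φ₂ [1, -1], with φ₁ + φ₂ on the diagonal and φ₁ -
  -- φ₂ off it.
  have hoff : offDiagonalMap (conjSum X₀ X₀ ψ₁ + conjSum X₀ X₀ ψ₂) φ
      (conjSum X₀ X₀ ψ₁ + conjSum X₀ X₀ ψ₂) =
      conjSum (fun i => Matrix.fromRows (X₀ i) (X₀ i)) (fun i => Matrix.fromRows (X₀ i) (X₀ i)) ψ₁ +
      conjSum (fun i => Matrix.fromRows (X₀ i) (-X₀ i))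
        (fun i => Matrix.fromRows (X₀ i) (-X₀ i)) ψ₂ := by
    rw [hφ']
    refine LinearMap.ext fun P => ?_
    ext1 a b
    rcases a with a | a <;> rcases b with b | b <;>
      simp [offDiagonalMap, conjSum_apply, sub_eq_add_neg]
  rw [hoff]
  exact (isCompletelyPositive_conjSum _ h₁).add (isCompletelyPositive_conjSum _ h₂)

end BimoduleMaps

/-! ### Kernels -/

section Kernels

variable {V A Y : Type*} {Ω : Set (NCSpace V)}
  [CStarAlgebra A] [NormedAddCommGroup Y] [InnerProductSpace ℂ Y]

/-- Any list of points, with repetitions, again gives a conjugated sum, now by block diagonal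
matrices; complete positivity of a kernel thus reduces to that of conjugated sums. -/
lemma blockMap_conjSum {I : Type*} [Fintype I]
    (X : I → ∀ Z : Ω, Matrix (Fin Z.1.1) (Fin Z.1.1) ℂ)
    (ψ : I → I → A →ₗ[ℂ] Y →L[ℂ] Y) {k : ℕ} (Z : Fin k → Ω) :
    blockMap (fun Z W => conjSum (fun i => X i Z) (fun i => X i W) ψ) Z =
      conjSum (fun i => Matrix.blockDiagonal' fun r => X i (Z r))
        (fun i => Matrix.blockDiagonal' fun r => X i (Z r)) ψ := by
  refine LinearMap.ext fun P => ?_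
  ext1 p q
  obtain ⟨p, a⟩ := p
  obtain ⟨q, b⟩ := q
  change conjSum (fun i => X i (Z p)) (fun i => X i (Z q)) ψ
    (Matrix.of fun a b => P ⟨p, a⟩ ⟨q, b⟩) a b = _
  rw [conjSum_apply, conjSum_apply]
  refine Finset.sum_congr rfl fun i _ => Finset.sum_congr rfl fun j _ => ?_
  rw [Fintype.sum_sigma, Finset.sum_eq_single p]
  · refine Finset.sum_congr rfl fun c _ => ?_
    rw [Fintype.sum_sigma, Finset.sum_eq_single q]
    · simp [Matrix.blockDiagonal'_apply]
    · intro r _ hr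
      simp [Matrix.blockDiagonal'_apply, Ne.symm hr]
    · simp
  · intro r _ hr
    simp [Matrix.blockDiagonal'_apply, Ne.symm hr]
  · simp

variable [CompleteSpace Y]

/-- The kernel `c K + c̄ K*`, where `K*(Z, W)(P) = K(W, Z)(P*)*`. -/
noncomputable def hermitianCombination (c : ℂ) (K : GradedKernel Ω A (Y →L[ℂ] Y)) :
    GradedKernel Ω A (Y →L[ℂ] Y) := fun Z W =>
  { toFun := fun P => c • K Z W P + star c • (K W Z P.conjTranspose).conjTranspose
    map_add' := fun P Q => by
      simp only [Matrix.conjTranspose_add, map_add, smul_add]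
      abel
    map_smul' := fun r P => by
      simp only [Matrix.conjTranspose_smul, map_smul, star_star, RingHom.id_apply, smul_add]
      rw [smul_comm r, smul_comm r] }

lemma hermitianCombination_apply (c : ℂ) (K : GradedKernel Ω A (Y →L[ℂ] Y)) (Z W : Ω)
    (P : Matrix (Fin Z.1.1) (Fin W.1.1) A) :
    hermitianCombination c K Z W P =
      c • K Z W P + star c • (K W Z P.conjTranspose).conjTranspose := rfl

lemma isHermitianKernel_hermitianCombination (c : ℂ) (K : GradedKernel Ω A (Y →L[ℂ] Y)) :
    ∀ (Z W : Ω) (P : Matrix (Fin Z.1.1) (Fin W.1.1) A),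
      hermitianCombination c K W Z P.conjTranspose =
        (hermitianCombination c K Z W P).conjTranspose := by
  intro Z W P
  simp only [hermitianCombination_apply, Matrix.conjTranspose_add, Matrix.conjTranspose_smul,
    Matrix.conjTranspose_conjTranspose, star_star]
  rw [add_comm]

lemma conjTranspose_rmul_lmul {m n m' n' E : Type*} [Fintype m] [Fintype n] [AddCommGroup E]
    [StarAddMonoid E] [Module ℂ E] [StarModule ℂ E] (α : Matrix m' m ℂ) (β : Matrix n' n ℂ)
    (P : Matrix m n E) :
    (rmul (lmul α P) β.conjTranspose).conjTranspose =
      rmul (lmul β P.conjTranspose) α.conjTranspose := by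
  ext i j
  simp only [rmul, lmul, Matrix.conjTranspose_apply, Matrix.of_apply, star_sum, star_smul,
    star_star, Finset.smul_sum]
  rw [Finset.sum_comm]
  simp only [smul_comm (star (α _ _))]

lemma rmul_lmul_add {m n m' n' E : Type*} [Fintype m] [Fintype n] [AddCommGroup E]
    [Module ℂ E] (α : Matrix m' m ℂ) (β : Matrix n n' ℂ) (P Q : Matrix m n E) :
    rmul (lmul α (P + Q)) β = rmul (lmul α P) β + rmul (lmul α Q) β := by
  ext i j
  simp [rmul, lmul, Finset.sum_add_distrib]

lemma rmul_lmul_smul {m n m' n' E : Type*} [Fintype m] [Fintype n] [AddCommGroup E]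
    [Module ℂ E] (α : Matrix m' m ℂ) (β : Matrix n n' ℂ) (c : ℂ) (P : Matrix m n E) :
    rmul (lmul α (c • P)) β = c • rmul (lmul α P) β := by
  ext i j
  simp only [rmul, lmul, Matrix.of_apply, Matrix.smul_apply, Finset.smul_sum]
  refine Finset.sum_congr rfl fun k _ => Finset.sum_congr rfl fun l _ => ?_
  rw [smul_comm (α i l) c, smul_comm (β k j) c]

lemma IsNCKernel.hermitianCombination [AddCommGroup V] [Module ℂ V]
    {K : GradedKernel Ω A (Y →L[ℂ] Y)}
    (hK : IsNCKernel K) (c : ℂ) : IsNCKernel (hermitianCombination c K) := by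
  intro Z Z' W W' α β hα hβ P
  simp only [hermitianCombination_apply]
  rw [rmul_lmul_add, rmul_lmul_smul, rmul_lmul_smul, hK Z Z' W W' α β hα hβ P,
    conjTranspose_rmul_lmul, ← hK W W' Z Z' β α hβ hα, conjTranspose_rmul_lmul]

variable [PartialOrder A] [StarOrderedRing A]

/-- The adjoint term is the conjugate of a form of K(W, Z) with x and y exchanged and D replaced by
D*, which has the same norm. -/
lemma IsEntrywiseBounded.hermitianCombination {K : GradedKernel Ω A (Y →L[ℂ] Y)}
    (hK : ∀ Z W, IsEntrywiseBounded (K Z W)) (c : ℂ) (Z W : Ω) :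
    IsEntrywiseBounded (hermitianCombination c K Z W) := by
  obtain ⟨C, hC0, hC⟩ := hK Z W
  obtain ⟨C', hC'0, hC'⟩ := hK W Z
  refine ⟨‖c‖ * C + ‖c‖ * C', by positivity, fun a b d e k D x y => ?_⟩
  have h1 := hC a b d e k D x y
  have h2 := hC' d e a b k (star D) y x
  have h3 : ∑ i, ∑ j, inner ℂ (x i) (_root_.hermitianCombination c K Z W
      (Matrix.single b e (D i j)) a d (y j)) =
      c * ∑ i, ∑ j, inner ℂ (x i) (K Z W (Matrix.single b e (D i j)) a d (y j)) +
      star c * starRingEnd ℂ (∑ i, ∑ j, inner ℂ (y i)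
        (K W Z (Matrix.single e b ((star D) i j)) d a (x j))) := by
    simp only [hermitianCombination_apply, Matrix.add_apply, Matrix.smul_apply, add_apply,
      smul_apply, inner_add_right, inner_smul_right, Finset.sum_add_distrib, Finset.mul_sum,
      map_sum, Matrix.conjTranspose_apply, Matrix.conjTranspose_single]
    congr 1
    rw [Finset.sum_comm]
    refine Finset.sum_congr rfl fun j _ => Finset.sum_congr rfl fun i _ => ?_
    rw [ContinuousLinearMap.star_eq_adjoint, ContinuousLinearMap.adjoint_inner_right,
      inner_conj_symm, CStarMatrix.star_apply]
  rw [h3]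
  refine (norm_add_le _ _).trans ?_
  rw [norm_mul, norm_mul, RCLike.norm_conj, norm_star]
  rw [norm_star] at h2
  calc _ ≤ ‖c‖ * (C * ‖D‖ * (∑ i, ‖x i‖ ^ 2 + ∑ i, ‖y i‖ ^ 2)) +
        ‖c‖ * (C' * ‖D‖ * (∑ i, ‖y i‖ ^ 2 + ∑ i, ‖x i‖ ^ 2)) :=
        add_le_add (mul_le_mul_of_nonneg_left h1 (norm_nonneg c))
          (mul_le_mul_of_nonneg_left h2 (norm_nonneg c))
    _ = _ := by ring

variable [AddCommGroup V] [Module ℂ V]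

lemma isCPNCKernel_conjSum {I : Type*} [Fintype I]
    {X : I → ∀ Z : Ω, Matrix (Fin Z.1.1) (Fin Z.1.1) ℂ}
    (hX : ∀ i (Z Z' : Ω) (α : Matrix (Fin Z'.1.1) (Fin Z.1.1) ℂ),
      lmul α Z.1.2 = rmul Z'.1.2 α → α * X i Z = X i Z' * α)
    {ψ : I → I → A →ₗ[ℂ] Y →L[ℂ] Y} (hψ : IsMatrixPositive ψ) :
    IsCPNCKernel (fun Z W : Ω => conjSum (fun i => X i Z) (fun i => X i W) ψ) := by
  refine ⟨fun Z Z' W W' α β hα hβ P => ?_, fun k Z => ?_⟩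
  · beta_reduce
    rw [conjSum_rmul, conjSum_lmul, lmul_conjSum, rmul_conjSum]
    simp only [hX _ _ _ α hα, hX _ _ _ β hβ]
  · rw [blockMap_conjSum]
    exact isCompletelyPositive_conjSum _ hψ

theorem IsNCKernel.exists_decomposition [Fintype Ω] {K : GradedKernel Ω A (Y →L[ℂ] Y)}
    (hK : IsNCKernel K) (hb : ∀ Z W, IsEntrywiseBounded (K Z W)) (hherm : IsHermitianKernel K) :
    ∃ K₁ K₂ : GradedKernel Ω A (Y →L[ℂ] Y), IsCPNCKernel K₁ ∧ IsCPNCKernel K₂ ∧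
      ∀ (Z W : Ω) (P : Matrix (Fin Z.1.1) (Fin W.1.1) A), K Z W P = K₁ Z W P - K₂ Z W P := by
  obtain ⟨X, ψ₁, ψ₂, hX, h₁, h₂, hφ⟩ := exists_conjSum_sub_conjSum
    (n := fun Z : Ω => Fin Z.1.1)
    (R := fun Z Z' => {α | lmul α Z.1.2 = rmul Z'.1.2 α}) hb
    (fun Z Z' W α hα P => by
      have := hK Z Z' W W α 1 hα (by ext; simp [lmul, rmul, Matrix.one_apply, ite_smul]) P
      rwa [Matrix.conjTranspose_one, rmul_one, rmul_one] at this)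
    hherm
  exact ⟨_, _, isCPNCKernel_conjSum hX h₁, isCPNCKernel_conjSum hX h₂, hφ⟩

theorem IsNCKernel.exists_decomposition_four [Fintype Ω] {K : GradedKernel Ω A (Y →L[ℂ] Y)}
    (hK : IsNCKernel K) (hb : ∀ Z W, IsEntrywiseBounded (K Z W)) :
    ∃ K₁ K₂ K₃ K₄ : GradedKernel Ω A (Y →L[ℂ] Y),
      IsCPNCKernel K₁ ∧ IsCPNCKernel K₂ ∧ IsCPNCKernel K₃ ∧ IsCPNCKernel K₄ ∧
      ∀ (Z W : Ω) (P : Matrix (Fin Z.1.1) (Fin W.1.1) A),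
        K Z W P = K₁ Z W P - K₂ Z W P + Complex.I • (K₃ Z W P - K₄ Z W P) := by
  -- The constants 1/2 and -i/2 give the real part (K + K*)/2 and the imaginary part (K - K*)/(2i),
  -- both Hermitian.
  obtain ⟨K₁, K₂, h₁, h₂, h₁₂⟩ := (hK.hermitianCombination (1 / 2)).exists_decomposition
    (IsEntrywiseBounded.hermitianCombination hb _) (isHermitianKernel_hermitianCombination _ K)
  obtain ⟨K₃, K₄, h₃, h₄, h₃₄⟩ :=
    (hK.hermitianCombination (-Complex.I / 2)).exists_decomposition
    (IsEntrywiseBounded.hermitianCombination hb _) (isHermitianKernel_hermitianCombination _ K)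
  refine ⟨K₁, K₂, K₃, K₄, h₁, h₂, h₃, h₄, fun Z W P => ?_⟩
  rw [← h₁₂, ← h₃₄, hermitianCombination_apply, hermitianCombination_apply]
  have e1 : star (1 / 2 : ℂ) = 1 / 2 := by simp
  have e2 : star (-Complex.I / 2) = Complex.I / 2 := by simp
  have e3 : Complex.I * (-Complex.I / 2) = 1 / 2 := by
    linear_combination (-1 / 2 : ℂ) * Complex.I_mul_I
  have e4 : Complex.I * (Complex.I / 2) = -(1 / 2) := by
    linear_combination (1 / 2 : ℂ) * Complex.I_mul_I
  rw [e1, e2, smul_add, smul_smul, smul_smul, e3, e4]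
  module

end Kernels
theorem theorem3p4 {A Y V : Type*} [CStarAlgebra A] [PartialOrder A] [StarOrderedRing A]
    [NormedAddCommGroup Y] [InnerProductSpace ℂ Y] [CompleteSpace Y]
    [AddCommGroup V] [Module ℂ V] :
    -- bimodule maps
    (∀ (M : ℕ) (S : Subalgebra ℂ (Matrix (Fin M) (Fin M) ℂ)),
      HasCompleteSpectralFactorization S →
      ∀ φ : Matrix (Fin M) (Fin M) A →ₗ[ℂ] Matrix (Fin M) (Fin M) (Y →L[ℂ] Y),
        IsCompletelyBounded φ → IsHermitianMap φ → IsBimoduleMap S φ →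
        (∃ Φ₁₁ Φ₂₂ : Matrix (Fin M) (Fin M) A →ₗ[ℂ] Matrix (Fin M) (Fin M) (Y →L[ℂ] Y),
          IsCompletelyPositive Φ₁₁ ∧ IsBimoduleMap S Φ₁₁ ∧
          IsCompletelyPositive Φ₂₂ ∧ IsBimoduleMap S Φ₂₂ ∧
          IsCompletelyPositive (offDiagonalMap Φ₁₁ φ Φ₂₂)) ∧
        (∃ φ₁ φ₂ : Matrix (Fin M) (Fin M) A →ₗ[ℂ] Matrix (Fin M) (Fin M) (Y →L[ℂ] Y),
          IsCompletelyPositive φ₁ ∧ IsBimoduleMap S φ₁ ∧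
          IsCompletelyPositive φ₂ ∧ IsBimoduleMap S φ₂ ∧ φ = φ₁ - φ₂)) ∧
    -- C*-algebras have the complete spectral-factorization property
    (∀ (M : ℕ) (S : Subalgebra ℂ (Matrix (Fin M) (Fin M) ℂ)),
      IsAdjointClosed S → HasCompleteSpectralFactorization S) ∧
    -- Hermitian nc kernels
    (∀ (Ω : Set (NCSpace V)) [Fintype Ω] [DecidableEq Ω],
      HasCompleteSpectralFactorization (intertwiningAlgebra Ω) →
      ∀ K : GradedKernel Ω A (Y →L[ℂ] Y),
        IsNCKernel K → IsCBKernel K → IsHermitianKernel K →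
        ∃ K₁ K₂ : GradedKernel Ω A (Y →L[ℂ] Y), IsCPNCKernel K₁ ∧ IsCPNCKernel K₂ ∧
          ∀ (Z W : Ω) (P : Matrix (Fin Z.1.1) (Fin W.1.1) A),
            K Z W P = K₁ Z W P - K₂ Z W P) ∧
    -- general nc kernels on admissible sets
    (∀ (Ω : Set (NCSpace V)) [Fintype Ω] [DecidableEq Ω],
      IsAdmissible Ω →
      ∀ K : GradedKernel Ω A (Y →L[ℂ] Y),
        IsNCKernel K → IsCBKernel K →
        ∃ K₁ K₂ K₃ K₄ : GradedKernel Ω A (Y →L[ℂ] Y),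
          IsCPNCKernel K₁ ∧ IsCPNCKernel K₂ ∧ IsCPNCKernel K₃ ∧ IsCPNCKernel K₄ ∧
          ∀ (Z W : Ω) (P : Matrix (Fin Z.1.1) (Fin W.1.1) A),
            K Z W P = K₁ Z W P - K₂ Z W P + Complex.I • (K₃ Z W P - K₄ Z W P)) := by
  exact ⟨fun M S _ φ hb hherm hS => by
      obtain ⟨φ₁, φ₂, h₁, hS₁, h₂, hS₂, hφ, hoff⟩ := exists_bimodule_decomposition hb hherm hS
      have h := h₁.add h₂
      have hS' : IsBimoduleMap S (φ₁ + φ₂) := fun α hα β hβ P => by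
        rw [LinearMap.add_apply, LinearMap.add_apply, rmul_lmul_add, hS₁ α hα β hβ, hS₂ α hα β hβ]
      exact ⟨⟨φ₁ + φ₂, φ₁ + φ₂, h, hS', h, hS', hoff⟩, φ₁, φ₂, h₁, hS₁, h₂, hS₂, hφ⟩,
    fun M S hS => hS.hasCompleteSpectralFactorization,
    fun Ω _ _ _ K hK hb hherm =>
      hK.exists_decomposition (fun Z W => (hb Z W).isEntrywiseBounded) hherm,
    fun Ω _ _ _ K hK hb =>
      hK.exists_decomposition_four fun Z W => (hb Z W).isEntrywiseBounded⟩
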